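/- **Setting.** A ribbon graph $G$ is a (possibly nonorientable) compact surface with boundary, decomposed into finitely many vertex discs and finitely many edge ribbons, each ribbon being glued along its two ends to the boundaries of the vertex discs. Its edge set is $E$, and $G$ is assumed to be connected; fix a total order on $E$. For $H\subseteq E$ let $F_H$ be the spanning ribbon subgraph of $G$ with edge set $H$, and let $R_H$ be the spanning ribbon subgraph with edge set $H$ of the Poincaré dual $G^*$ (edges of $G^*$ are identified with those of $G$). If $F=F_H$, put $F^*=R_{E\setminus H}$. For graphs, $c$, $v$, $e$ denote the numbers of connected components, vertices and edges and $n=e-v+c$ is the nullity; $bc$ is the number of boundary components of a ribbon graph, and $s(F)=2c(F)-v(F)+e(F)-bc(F)$. The generalized Krushkal polynomial is $$\widetilde P_G(X,Y,A,B)=\sum_{F\subseteq G}X^{c(F)-c(G)}\,Y^{c(F^*)-c(G^*)}\,A^{s(F)/2}\,B^{s(F^*)/2},$$ the sum being over all spanning subgraphs $F$ of $G$; it is a polynomial in $X$, $Y$, $A^{1/2}$, $B^{1/2}$. For an ordinary graph $\Gamma$ (loops and multiple edges allowed) put $$T_\Gamma(X,Y)=\sum_{W\subseteq\Gamma}X^{c(W)-c(\Gamma)}\,Y^{n(W)},$$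 the sum being over all spanning subgraphs $W$ of $\Gamma$. **Quasi-trees and activities.** A quasi-tree of $G$ is a spanning subgraph $Q$ with $bc(Q)=1$; let $\mathcal Q_G$ be the set of quasi-trees of $G$, and identify $Q$ with its edge set. The partial dual $G^{H}$ is obtained from $G$ by gluing discs, the new vertices, to the boundary components of $F_H$ and removing the interiors of the old vertex discs. For $Q\in\mathcal Q_G$ the ribbon graph $G^{Q}$ has exactly one vertex. Two edges link each other (with respect to $Q$) if their ribbons are met alternately along the boundary of this vertex. An edge is live if it links no lower-ordered edge, and dead otherwise; it is internal if it belongs to $Q$, and external otherwise; it is orientable if it forms an orientable loop in $G^{Q}$, and nonorientable otherwise. Let $\mathcal I_o(Q)$ and $\mathcal E_o(Q)$ be the sets of internal and of external edges that are live and orientable; let $\mathcal{VI}(Q)$ be the set of internal edges that are dead, or live and nonorientable, and let $\mathcal{VE}(Q)$ be the set of external edges that are dead, or live and nonorientable. Let $G_Q$ be the graph whose vertices are the connected components of $F_{\mathcal{VI}(Q)}$ and whose edges are the edges of $G$ in $\mathcal I_o(Q)$, and let $G^*_{Q^*}$ be the graph whose vertices are the connected components of $R_{\mathcal{VE}(Q)}$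 and whose edges are the edges of $G^*$ in $\mathcal E_o(Q)$, each edge joining the components that contain its ends. **Theorem.** For every connected ribbon graph $G$ and every total order on its edges, $$\widetilde P_G(X,Y,A,B)=\sum_{Q\in\mathcal Q_G}T_{G_Q}(X,A)\;T_{G^*_{Q^*}}(Y,B)\;A^{s(F_{\mathcal{VI}(Q)})/2}\;B^{s(R_{\mathcal{VE}(Q)})/2}$$ as an identity of Laurent polynomials in $X$, $Y$, $A^{1/2}$, $B^{1/2}$. That is, it holds for all nonzero elements $X$, $Y$, $A$, $B$ of any field, with $A^{1/2}$, $B^{1/2}$ any chosen square roots of $A$, $B$ in that field (in particular for indeterminates $X$, $Y$, $A^{1/2}$, $B^{1/2}$). -/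

import Mathlib

noncomputable section

open Finset

/-! ### Ordinary (multi)graphs and their Tutte polynomial -/

namespace Graph

variable {α β : Type*}

/-- The connected components of a graph: vertices modulo the equivalence relation generated
by adjacency. -/
def Component (Γ : Graph α β) : Type _ :=
  Quot (fun x y : Γ.vertexSet => Γ.Adj x y)

/-- The number `c(Γ)` of connected components. -/
def numComponents (Γ : Graph α β) : ℕ := Nat.card Γ.Component

/-- The nullity `n(Γ) = e(Γ) - v(Γ) + c(Γ)`. -/
def nullity (Γ : Graph α β) : ℤ :=
  (Γ.edgeSet.ncard : ℤ) - (Γ.vertexSet.ncard : ℤ) + (Γ.numComponents : ℤ)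

open Classical in
/-- The Tutte polynomial in the normalization `∑_F X^(c(F) - c(Γ)) Y^n(F)`, the sum being over all
spanning subgraphs `F` of `Γ`, evaluated at elements `X`, `Y` of a field. The exponents are
integers, so at nonzero `X`, `Y` no truncated subtraction or junk value enters. -/
def tutte [Fintype β] (Γ : Graph α β) {K : Type*} [Field K] (X Y : K) : K :=
  ∑ F : Set β with F ⊆ Γ.edgeSet,
    X ^ (((Γ.restrict F).numComponents : ℤ) - (Γ.numComponents : ℤ)) * Y ^ (Γ.restrict F).nullity

/-- The graph whose vertices are the connected components of the spanning subgraph of `Γ` with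
edge set `D`, and whose edges are the edges of `Γ` in `I`; an edge joining `u` to `v` in `Γ` joins
the component of `u` to the component of `v`. -/
def componentGraph (Γ : Graph α β) (D I : Set β) : Graph (Γ.restrict D).Component β where
  vertexSet := Set.univ
  edgeSet := Γ.edgeSet ∩ I
  IsLink e x y := e ∈ I ∧ ∃ u v : Γ.vertexSet, Γ.IsLink e u v ∧ x = Quot.mk _ u ∧ y = Quot.mk _ v
  isLink_symm _ _ :=
    { symm := fun _ _ ⟨h, u, v, huv, hx, hy⟩ => ⟨h, v, u, huv.symm, hy, hx⟩ }
  eq_or_eq_of_isLink_of_isLink := by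
    rintro e x y v w ⟨-, a, b, hab, rfl, rfl⟩ ⟨-, c, d, hcd, rfl, rfl⟩
    rcases hab.left_eq_or_eq hcd with h | h
    · exact Or.inl (congrArg _ (Subtype.ext h))
    · exact Or.inr (congrArg _ (Subtype.ext h))
  edge_mem_iff_exists_isLink e := by
    constructor
    · rintro ⟨he, hI⟩
      obtain ⟨u, v, h⟩ := Graph.exists_isLink_of_mem_edgeSet he
      exact ⟨_, _, hI, ⟨u, h.left_mem⟩, ⟨v, h.right_mem⟩, h, rfl, rfl⟩
    · rintro ⟨_, _, hI, u, v, h, -, -⟩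
      exact ⟨h.edge_mem, hI⟩
  left_mem_of_isLink _ _ _ _ := Set.mem_univ _

end Graph

/-! ### Ribbon graphs -/

/-- A (possibly nonorientable) ribbon graph, given by its handle decomposition into vertex discs
and edge ribbons. `E` is the set of edges and `V₀` the set of isolated vertices (discs with no
ribbon attached). The ribbon of the edge `e` is a rectangle with four corners `(e, i, j)`: `i`
tells which of the two ends of the ribbon the corner lies on and `j` which of its two long
(free) sides. The segment from `(e, i, false)` to `(e, i, true)` is attached to the boundary of a
vertex disc; the complement of all these segments in the boundaries of the non-isolated vertex
discs is a union of arcs joining corners in pairs, and `arc` sends each corner to the other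
endpoint of its arc. Any fixed-point free involution occurs, and it determines the ribbon graph. -/
structure RibbonGraph (V₀ E : Type*) where
  arc : E × Bool × Bool → E × Bool × Bool
  arc_arc : ∀ x, arc (arc x) = x
  arc_ne : ∀ x, arc x ≠ x

namespace RibbonGraph

variable {V₀ E : Type*}

/-- Move along the end of a ribbon (the segment glued to a vertex disc) to its other corner. -/
def endFlip (x : E × Bool × Bool) : E × Bool × Bool := (x.1, x.2.1, !x.2.2)

/-- Move along a free side of a ribbon to its other corner. -/
def sideFlip (x : E × Bool × Bool) : E × Bool × Bool := (x.1, !x.2.1, x.2.2)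

/-- One passes from `x` to `y` along the boundary of a vertex disc, by an arc or an end. -/
def VertexStep (G : RibbonGraph V₀ E) (x y : E × Bool × Bool) : Prop :=
  y = G.arc x ∨ y = endFlip x

/-- The vertices: the boundary circles of the vertex discs meeting a ribbon, and the isolated
vertices. -/
def Vertex (G : RibbonGraph V₀ E) : Type _ := Quot G.VertexStep ⊕ V₀

/-- The vertex at the end `i` of the edge `e`. -/
def endpoint (G : RibbonGraph V₀ E) (e : E) (i : Bool) : G.Vertex :=
  Sum.inl (Quot.mk _ (e, i, false))

/-- The underlying graph. -/
def graph (G : RibbonGraph V₀ E) : Graph G.Vertex E where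
  vertexSet := Set.univ
  edgeSet := Set.univ
  IsLink e x y := ∃ i : Bool, x = G.endpoint e i ∧ y = G.endpoint e (!i)
  isLink_symm _ _ := { symm := fun _ _ ⟨i, hx, hy⟩ => ⟨!i, hy, by simpa using hx⟩ }
  eq_or_eq_of_isLink_of_isLink := by
    rintro e _ _ _ _ ⟨i, rfl, rfl⟩ ⟨k, rfl, rfl⟩
    cases i <;> cases k <;> simp
  edge_mem_iff_exists_isLink e := ⟨fun _ => ⟨_, _, false, rfl, rfl⟩, fun _ => Set.mem_univ _⟩
  left_mem_of_isLink _ _ _ _ := Set.mem_univ _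

/-- The underlying graph of `F_H`, the spanning ribbon subgraph of `G` with edge set `H`. -/
def spanning (G : RibbonGraph V₀ E) (H : Set E) : Graph G.Vertex E := G.graph.restrict H

/-- One passes from `x` to `y` along the boundary of the spanning ribbon subgraph with edge set
`H`: by an arc, along a free side of a ribbon in `H`, or along the segment of a vertex disc to
which a ribbon not in `H` used to be attached. -/
def BoundaryStep (G : RibbonGraph V₀ E) (H : Set E) (x y : E × Bool × Bool) : Prop :=
  y = G.arc x ∨ (x.1 ∈ H ∧ y = sideFlip x) ∨ (x.1 ∉ H ∧ y = endFlip x)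

/-- The boundary components of the spanning ribbon subgraph with edge set `H`; each isolated
vertex of `G` contributes one. -/
def BoundaryComponent (G : RibbonGraph V₀ E) (H : Set E) : Type _ :=
  Quot (G.BoundaryStep H) ⊕ V₀

/-- `c(F_H)`. -/
def c (G : RibbonGraph V₀ E) (H : Set E) : ℕ := (G.spanning H).numComponents

/-- `bc(F_H)`. -/
def bc (G : RibbonGraph V₀ E) (H : Set E) : ℕ := Nat.card (G.BoundaryComponent H)

/-- `s(F_H) = 2 c(F_H) - v(F_H) + e(F_H) - bc(F_H)`. -/
def s (G : RibbonGraph V₀ E) (H : Set E) : ℤ :=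
  2 * (G.c H : ℤ) - ((G.spanning H).vertexSet.ncard : ℤ) + ((G.spanning H).edgeSet.ncard : ℤ)
    - (G.bc H : ℤ)

/-- `G` is connected: it has exactly one connected component. -/
def Connected (G : RibbonGraph V₀ E) : Prop := G.graph.numComponents = 1

/-- `F_H` is a quasi-tree. -/
def IsQuasiTree (G : RibbonGraph V₀ E) (H : Set E) : Prop := G.bc H = 1

open Classical in
/-- Exchange the ends and the free sides of the ribbons in `H`. -/
def swapOn (H : Set E) (x : E × Bool × Bool) : E × Bool × Bool :=
  if x.1 ∈ H then (x.1, x.2.2, x.2.1) else x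

/-- The partial dual `G^H`: discs are glued to the boundary components of `F_H` and the interiors
of the old vertex discs are removed. The ribbons and the arcs stay what they are, but a ribbon in
`H` is now attached to the new vertex discs along its former free sides. -/
def partialDual (G : RibbonGraph V₀ E) (H : Set E) : RibbonGraph V₀ E where
  arc x := swapOn H (G.arc (swapOn H x))
  arc_arc x := by
    have h : ∀ y : E × Bool × Bool, swapOn H (swapOn H y) = y := by
      intro y; by_cases hy : y.1 ∈ H <;> simp [swapOn, hy]
    simp [h, G.arc_arc]
  arc_ne x hx := by
    have h : ∀ y : E × Bool × Bool, swapOn H (swapOn H y) = y := by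
      intro y; by_cases hy : y.1 ∈ H <;> simp [swapOn, hy]
    exact G.arc_ne (swapOn H x) (by simpa [h] using congrArg (swapOn H) hx)

/-- The Poincaré dual `G^*`; the edge `e^*` dual to `e` is again called `e`. -/
def dual (G : RibbonGraph V₀ E) : RibbonGraph V₀ E := G.partialDual Set.univ

/-- Traverse the boundary of a vertex disc from a corner at which a ribbon end is entered to the
next such corner: first along that end, then along the following arc. -/
def step (G : RibbonGraph V₀ E) (x : E × Bool × Bool) : E × Bool × Bool := G.arc (endFlip x)

/-- In one turn around the boundary of a vertex disc of `G`, starting at an end of `e`, one meets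
`e, f, e, f` in this order. -/
def Alternate (G : RibbonGraph V₀ E) (e f : E) : Prop :=
  ∃ x : E × Bool × Bool, ∃ p q r : ℕ,
    0 < p ∧ p < q ∧ q < r ∧ r < Function.minimalPeriod G.step x ∧
    x.1 = e ∧ (G.step^[p] x).1 = f ∧ (G.step^[q] x).1 = e ∧ (G.step^[r] x).1 = f

/-- The surface `F_H` is orientable: the vertex discs and the ribbons in `H` can be oriented
coherently. An orientation of a disc or of a rectangle is encoded by a 2-colouring of its corners
that alternates along its boundary, and coherence means that the colourings agree. -/
def Orientable (G : RibbonGraph V₀ E) (H : Set E) : Prop :=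
  ∃ ε : E × Bool × Bool → Bool, ∀ x,
    ε (G.arc x) ≠ ε x ∧ ε (endFlip x) ≠ ε x ∧ (x.1 ∈ H → ε (sideFlip x) ≠ ε x)

/-- With respect to the quasi-tree `Q`, the edge `e` links the edge `f`: their ribbons are met
alternately along the boundary of the vertex of `G^Q`. -/
def Links (G : RibbonGraph V₀ E) (Q : Set E) (e f : E) : Prop := (G.partialDual Q).Alternate e f

/-- `e` is live with respect to `Q`: it links no lower-ordered edge. -/
def Live [LinearOrder E] (G : RibbonGraph V₀ E) (Q : Set E) (e : E) : Prop :=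
  ∀ f, f < e → ¬ G.Links Q e f

/-- `e` is orientable with respect to `Q`: it forms an orientable loop in `G^Q`. -/
def OrientableEdge (G : RibbonGraph V₀ E) (Q : Set E) (e : E) : Prop :=
  (G.partialDual Q).Orientable {e}

section Activities

variable [LinearOrder E] (G : RibbonGraph V₀ E) (Q : Set E)

/-- The internally dead edges. -/
def DI : Set E := {e | e ∈ Q ∧ ¬ G.Live Q e}

/-- The internally live orientable edges. -/
def Io : Set E := {e | e ∈ Q ∧ G.Live Q e ∧ G.OrientableEdge Q e}

/-- The internally live nonorientable edges. -/
def In : Set E := {e | e ∈ Q ∧ G.Live Q e ∧ ¬ G.OrientableEdge Q e}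

/-- The externally dead edges. -/
def DE : Set E := {e | e ∉ Q ∧ ¬ G.Live Q e}

/-- The externally live orientable edges. -/
def Eo : Set E := {e | e ∉ Q ∧ G.Live Q e ∧ G.OrientableEdge Q e}

/-- The externally live nonorientable edges. -/
def En : Set E := {e | e ∉ Q ∧ G.Live Q e ∧ ¬ G.OrientableEdge Q e}

def VI : Set E := G.DI Q ∪ G.In Q

def VE : Set E := G.DE Q ∪ G.En Q

/-- The graph `G_Q`: its vertices are the components of `F_VI(Q)`, its edges those in `Io(Q)`. -/
def internalGraph : Graph (G.spanning (G.VI Q)).Component E :=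
  G.graph.componentGraph (G.VI Q) (G.Io Q)

/-- The graph `G^*_{Q^*}`: its vertices are the components of the spanning subgraph `R_VE(Q)` of
`G^*`, its edges those in `Eo(Q)`, considered as edges of `G^*`. -/
def externalGraph : Graph (G.dual.spanning (G.VE Q)).Component E :=
  G.dual.graph.componentGraph (G.VE Q) (G.Eo Q)

end Activities

/-- The generalized Krushkal polynomial
`∑_F X^(c(F) - c(G)) Y^(c(F^*) - c(G^*)) A^(s(F)/2) B^(s(F^*)/2)`, the sum being over all spanning
subgraphs `F` of `G`, where `F^*` is the spanning subgraph of `G^*` with the complementary edges.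
It is a polynomial in `X`, `Y`, `a = A^(1/2)`, `b = B^(1/2)`, evaluated here at elements of a
field; with `X, Y, a, b` the indeterminates of a rational function field it is the polynomial
itself. -/
def krushkal [Fintype E] (G : RibbonGraph V₀ E) {K : Type*} [Field K] (X Y a b : K) : K :=
  ∑ F : Set E,
    X ^ ((G.c F : ℤ) - (G.c Set.univ : ℤ)) * Y ^ ((G.dual.c Fᶜ : ℤ) - (G.dual.c Set.univ : ℤ))
      * a ^ G.s F * b ^ G.dual.s Fᶜ

end RibbonGraph

end

open scoped symmDiff

/-! For a quasi-tree Q let L be its set of live orientable edges; the interval of Q consists of the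
F with F ∆ Q ⊆ L. The theorem follows from two facts: the intervals partition all spanning
subgraphs, and each interval contributes one summand of the right-hand side.

Partition. Passing to the partial dual gives bc(G^Q, S) = bc(G, S ∆ Q), so everything can be read
around the single vertex of G^Q. An orientable loop linking no edge of S splits a boundary component
when it is added to S. A nonorientable loop, or an orientable loop together with an edge linking it,
leaves a single boundary component. Hence (`mem_liveOrientable_iff`) e lies in L exactly when no
quasi-tree agreeing with Q above e differs from Q at e. Going down from the greatest edge, one
therefore builds the unique Q whose interval contains F: copy the status of e in F whenever some
quasi-tree consistent with the earlier choices allows it; otherwise the status is forced and e is in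
L (`existsUnique_isQuasiTree`).

One interval. Adding the edges of F ∆ Q in increasing order gives bc(F) = 1 + |F ∆ Q| (`bc_eq`). So
adding an edge of Eo raises bc and cannot merge connected components: c(F) depends only on W = F ∩
Io, and s(F) = s(VI) + 2 n(W), with n the nullity in G_Q (`c_eq`, `IsQuasiTree.s_eq`). Complements
in the dual satisfy the same formulas, because the partial dual of G^* along the complement of Q is
again G^Q. Since W and Fᶜ ∩ Eo vary independently, the sum over the interval factors into the two
Tutte polynomials. -/

theorem Finset.even_card_of_fixedPointFree_involution {T : Type*} (C : Finset T) (f : T → T)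
    (hC : ∀ x ∈ C, f x ∈ C) (hf : ∀ x ∈ C, f (f x) = x) (hne : ∀ x ∈ C, f x ≠ x) :
    Even C.card := by
  have h : ∑ _x ∈ C, (1 : ZMod 2) = 0 :=
    Finset.sum_involution (fun x _ => f x) (fun _ _ => by decide) (fun x hx _ => hne x hx)
      hC hf
  rw [Finset.sum_const, nsmul_one] at h
  exact (ZMod.natCast_eq_zero_iff_even).1 h

namespace RibbonGraph

variable {V₀ E : Type*}

/-! ### The two flips of a ribbon's corners -/

@[simp] theorem endFlip_endFlip (x : E × Bool × Bool) : endFlip (endFlip x) = x := by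
  simp [endFlip]

@[simp] theorem sideFlip_sideFlip (x : E × Bool × Bool) : sideFlip (sideFlip x) = x := by
  simp [sideFlip]

@[simp] theorem endFlip_fst (x : E × Bool × Bool) : (endFlip x).1 = x.1 := rfl

@[simp] theorem sideFlip_fst (x : E × Bool × Bool) : (sideFlip x).1 = x.1 := rfl

theorem endFlip_ne (x : E × Bool × Bool) : endFlip x ≠ x := by
  obtain ⟨e, i, j⟩ := x
  simp [endFlip]

theorem sideFlip_ne (x : E × Bool × Bool) : sideFlip x ≠ x := by
  obtain ⟨e, i, j⟩ := x
  simp [sideFlip]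

theorem corner_cases {x y : E × Bool × Bool} (h : y.1 = x.1) :
    y = x ∨ y = endFlip x ∨ y = sideFlip x ∨ y = sideFlip (endFlip x) := by
  obtain ⟨e, i, j⟩ := x
  obtain ⟨f, k, l⟩ := y
  obtain rfl : f = e := h
  cases i <;> cases j <;> cases k <;> cases l <;> simp [endFlip, sideFlip]

/-! ### Exchanging ends and sides -/

@[simp] theorem swapOn_swapOn (H : Set E) (x : E × Bool × Bool) :
    swapOn H (swapOn H x) = x := by
  by_cases hx : x.1 ∈ H <;> simp [swapOn, hx]

@[simp] theorem swapOn_fst (H : Set E) (x : E × Bool × Bool) : (swapOn H x).1 = x.1 := by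
  by_cases hx : x.1 ∈ H <;> simp [swapOn, hx]

theorem swapOn_endFlip_of_mem {H : Set E} {x : E × Bool × Bool} (hx : x.1 ∈ H) :
    swapOn H (endFlip x) = sideFlip (swapOn H x) := by
  simp [swapOn, hx, endFlip, sideFlip]

theorem swapOn_endFlip_of_notMem {H : Set E} {x : E × Bool × Bool} (hx : x.1 ∉ H) :
    swapOn H (endFlip x) = endFlip (swapOn H x) := by
  simp [swapOn, hx, endFlip]

theorem swapOn_sideFlip_of_mem {H : Set E} {x : E × Bool × Bool} (hx : x.1 ∈ H) :
    swapOn H (sideFlip x) = endFlip (swapOn H x) := by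
  simp [swapOn, hx, endFlip, sideFlip]

theorem swapOn_sideFlip_of_notMem {H : Set E} {x : E × Bool × Bool} (hx : x.1 ∉ H) :
    swapOn H (sideFlip x) = sideFlip (swapOn H x) := by
  simp [swapOn, hx, sideFlip]

/-- On ribbons in Q ends and sides trade roles, and so do presence in S and absence from it; this is
why S becomes S ∆ Q. -/
theorem boundaryStep_partialDual (G : RibbonGraph V₀ E) (Q S : Set E) (x y : E × Bool × Bool) :
    (G.partialDual Q).BoundaryStep S x y ↔
      G.BoundaryStep (S ∆ Q) (swapOn Q x) (swapOn Q y) := by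
  have key : ∀ a b, swapOn Q a = b ↔ a = swapOn Q b := fun a b =>
    ⟨fun h => by rw [← h, swapOn_swapOn], fun h => by rw [h, swapOn_swapOn]⟩
  simp only [BoundaryStep, partialDual, key, swapOn_fst, Set.mem_symmDiff]
  by_cases hQ : x.1 ∈ Q <;> by_cases hS : x.1 ∈ S <;>
    simp [hQ, hS, ← swapOn_endFlip_of_mem, ← swapOn_sideFlip_of_mem,
      ← swapOn_endFlip_of_notMem, ← swapOn_sideFlip_of_notMem]

/-- The boundary circles of a partial dual. -/
noncomputable def boundaryEquivPartialDual (G : RibbonGraph V₀ E) (Q S : Set E) :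
    Quot ((G.partialDual Q).BoundaryStep S) ≃ Quot (G.BoundaryStep (S ∆ Q)) :=
  Quot.congr ⟨swapOn Q, swapOn Q, swapOn_swapOn Q, swapOn_swapOn Q⟩
    (fun x y => G.boundaryStep_partialDual Q S x y)

theorem bc_partialDual (G : RibbonGraph V₀ E) (Q S : Set E) :
    (G.partialDual Q).bc S = G.bc (S ∆ Q) :=
  Nat.card_congr ((G.boundaryEquivPartialDual Q S).sumCongr (Equiv.refl V₀))

theorem bc_dual_compl (G : RibbonGraph V₀ E) (S : Set E) : G.dual.bc Sᶜ = G.bc S := by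
  rw [dual, bc_partialDual]
  congr 1
  ext e
  simp [Set.mem_symmDiff]

/-! ### Inserting one edge -/

/-- The involution of the corners used along the boundary of `F_S`, besides the arcs. -/
theorem exists_boundaryFlip (G : RibbonGraph V₀ E) (S : Set E) :
    ∃ b : E × Bool × Bool → E × Bool × Bool, (∀ x, b (b x) = x) ∧ (∀ x, b x ≠ x) ∧
      (∀ x, (b x).1 = x.1) ∧ ∀ x y, G.BoundaryStep S x y ↔ y = G.arc x ∨ y = b x := by
  classical
  refine ⟨fun x => if x.1 ∈ S then sideFlip x else endFlip x, fun x => ?_, fun x => ?_,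
    fun x => ?_, fun x y => ?_⟩ <;> by_cases hx : x.1 ∈ S <;>
    simp [hx, endFlip_ne, sideFlip_ne, BoundaryStep]

/-- Every strand of the boundary of `F_S` that enters the ribbon of `e` also leaves it. -/
theorem exists_corner_of_strand [Finite E] (G : RibbonGraph V₀ E) (S : Set E)
    (x : E × Bool × Bool) :
    ∃ y, y ≠ x ∧ y.1 = x.1 ∧
      (Quot.mk (fun u v => v = G.arc u ∨ (u.1 ≠ x.1 ∧ G.BoundaryStep S u v)) y =
        Quot.mk _ x) := by
  classical
  have := Fintype.ofFinite E
  by_contra! hcon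
  obtain ⟨b, hbb, hbne, hb1, hb⟩ := G.exists_boundaryFlip S
  -- Parity argument: arcs pair off the class C of x, so |C| is even. If C contained no other corner
  -- of this ribbon, `b` would pair off C without x, making |C| odd.
  set r : E × Bool × Bool → E × Bool × Bool → Prop :=
    fun u v => v = G.arc u ∨ (u.1 ≠ x.1 ∧ G.BoundaryStep S u v) with hr
  set C : Finset (E × Bool × Bool) := {z | Quot.mk r z = Quot.mk r x} with hC
  have h1 : Even C.card := by
    refine C.even_card_of_fixedPointFree_involution G.arc (fun z hz => ?_)
      (fun z _ => G.arc_arc z) (fun z _ => G.arc_ne z)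
    simp only [hC, Finset.mem_filter, Finset.mem_univ, true_and] at hz ⊢
    rw [← hz]
    exact Eq.symm <| Quot.sound <| Or.inl rfl
  have h2 : Even (C.erase x).card := by
    have key : ∀ z ∈ C.erase x, z.1 ≠ x.1 := by
      intro z hz h
      rw [Finset.mem_erase] at hz
      exact hcon z hz.1 h (by simpa [hC] using hz.2)
    refine (C.erase x).even_card_of_fixedPointFree_involution b (fun z hz => ?_)
      (fun z _ => hbb z) (fun z _ => hbne z)
    have h3 := key z hz
    refine Finset.mem_erase.2 ⟨fun h => h3 (by rw [← hb1 z, h]), ?_⟩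
    have hz' := (Finset.mem_erase.1 hz).2
    simp only [hC, Finset.mem_filter, Finset.mem_univ, true_and] at hz' ⊢
    rw [← hz']
    exact Eq.symm <| Quot.sound <| Or.inr ⟨h3, (hb _ _).2 (Or.inr rfl)⟩
  have hx : x ∈ C := by simp [hC]
  have h3 := Finset.card_erase_add_one hx
  rw [← h3] at h1
  exact (Nat.not_even_iff_odd.2 h2.add_one) h1

/-- If the two sides of a ribbon lie on different boundary components, then these are merged when
the ribbon is removed. -/
theorem bc_insert_of_sides_ne [Finite V₀] [Finite E] (G : RibbonGraph V₀ E) {S : Set E} {e : E}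
    (he : e ∉ S)
    (h : Quot.mk (G.BoundaryStep (insert e S)) (e, false, false) ≠
      Quot.mk _ (e, false, true)) :
    G.bc (insert e S) = G.bc S + 1 := by
  classical
  set r' := G.BoundaryStep (insert e S) with hr'
  set r := G.BoundaryStep S with hr
  have hside : ∀ j, Quot.mk r' (e, true, j) = Quot.mk r' (e, false, j) := fun j =>
    Eq.symm <| Quot.sound <| Or.inr <| Or.inl ⟨Set.mem_insert _ _, rfl⟩
  have hend : ∀ i, Quot.mk r (e, i, false) = Quot.mk r (e, i, true) := fun i =>
    Quot.sound (Or.inr (Or.inr ⟨he, rfl⟩))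
  have hoff : ∀ u v : E × Bool × Bool, u.1 ≠ e → (r' u v ↔ r u v) := by
    intro u v hu
    simp [hr, hr', BoundaryStep, hu]
  have harc' : ∀ u, Quot.mk r' (G.arc u) = Quot.mk r' u := fun u => Eq.symm <| Quot.sound <| Or.inl rfl
  have harc : ∀ u, Quot.mk r (G.arc u) = Quot.mk r u := fun u => Eq.symm <| Quot.sound <| Or.inl rfl
  -- A strand avoiding the ribbon of e is part of the boundary both with and without e. With e
  -- present it cannot join the two sides, which lie on different components, so it returns to the
  -- other corner of the side it left.
  have hstrand : ∀ j, Quot.mk r (e, true, j) = Quot.mk r (e, false, j) := by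
    intro j
    obtain ⟨⟨e', i, k⟩, hy, rfl : e' = e, hq⟩ := G.exists_corner_of_strand S (e, false, j)
    have hq1 : Quot.mk r (e', i, k) = Quot.mk r (e', false, j) := by
      refine congrArg (Quot.lift (Quot.mk r) ?_) hq
      rintro u v (rfl | ⟨-, huv⟩)
      · exact (harc u).symm
      · exact Quot.sound huv
    have hq2 : Quot.mk r' (e', i, k) = Quot.mk r' (e', false, j) := by
      refine congrArg (Quot.lift (Quot.mk r') ?_) hq
      rintro u v (rfl | ⟨hu, huv⟩)
      · exact (harc' u).symm
      · exact Quot.sound ((hoff u v hu).2 huv)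
    cases i <;> cases j <;> cases k <;> simp_all
  set a := Quot.mk r' (e, false, false) with ha
  set b := Quot.mk r' (e, false, true) with hb
  have hab : Quot.mk r (e, false, false) = Quot.mk r (e, false, true) := hend false
  -- the map which identifies the two components
  let f : Quot r → {q : Quot r' // q ≠ b} := Quot.lift
    (fun x => if hx : Quot.mk r' x = b then ⟨a, h⟩ else ⟨Quot.mk r' x, hx⟩) (by
      intro x y hxy
      by_cases hx : x.1 = e
      · rcases hxy with rfl | ⟨hS, -⟩ | ⟨-, rfl⟩
        · simp only [harc']
        · exact absurd (hx ▸ hS) he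
        · obtain ⟨e', i, j⟩ := x
          obtain rfl : e' = e := hx
          cases i <;> cases j <;> simp [endFlip, hside, ← ha, ← hb, h]
      · have := Quot.sound ((hoff x y hx).2 hxy)
        simp only [this])
  have hg : ∀ x y : E × Bool × Bool, r' x y → Quot.mk r x = Quot.mk r y := by
    rintro x y hxy
    by_cases hx : x.1 = e
    · rcases hxy with rfl | ⟨-, rfl⟩ | ⟨hS, -⟩
      · exact (harc x).symm
      · obtain ⟨e', i, j⟩ := x
        obtain rfl : e' = e := hx
        cases i <;> simp [sideFlip, hstrand]
      · exact absurd (hx ▸ Set.mem_insert _ _) hS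
    · exact Quot.sound ((hoff x y hx).1 hxy)
  let g : {q : Quot r' // q ≠ b} → Quot r := fun q => Quot.lift (Quot.mk r) hg q.1
  have hga : Quot.lift (Quot.mk r) hg a = Quot.lift (Quot.mk r) hg b := hab
  let φ : Quot r ≃ {q : Quot r' // q ≠ b} :=
    { toFun := f
      invFun := g
      left_inv := by
        rintro ⟨x⟩
        change g (if hx : Quot.mk r' x = b then ⟨a, h⟩ else ⟨Quot.mk r' x, hx⟩) = Quot.mk r x
        split_ifs with hx
        · change Quot.lift (Quot.mk r) hg a = _
          rw [hga, ← hx]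
        · rfl
      right_inv := by
        rintro ⟨⟨x⟩, hx⟩
        change (if hx : Quot.mk r' x = b then ⟨a, h⟩ else ⟨Quot.mk r' x, hx⟩ :
          {q : Quot r' // q ≠ b}) = _
        exact dif_neg hx }
  have := Fintype.ofFinite (Quot r')
  have hcard : Nat.card (Quot r') = Nat.card (Quot r) + 1 := by
    have h0 : 0 < Fintype.card (Quot r') := Fintype.card_pos_iff.2 ⟨b⟩
    rw [Nat.card_congr φ, Nat.card_eq_fintype_card, Nat.card_eq_fintype_card,
      Fintype.card_subtype_compl, Fintype.card_subtype_eq]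
    omega
  have : Finite (Quot r) := Finite.of_equiv _ φ.symm
  change Nat.card (Quot r' ⊕ V₀) = Nat.card (Quot r ⊕ V₀) + 1
  rw [Nat.card_sum, Nat.card_sum, hcard]
  omega

theorem mk_partialDual_eq_iff (G : RibbonGraph V₀ E) (Q S : Set E) (x y : E × Bool × Bool) :
    Quot.mk ((G.partialDual Q).BoundaryStep S) x = Quot.mk _ y ↔
      Quot.mk (G.BoundaryStep (S ∆ Q)) (swapOn Q x) = Quot.mk _ (swapOn Q y) :=
  (G.boundaryEquivPartialDual Q S).apply_eq_iff_eq.symm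

/-- If the two ends of a ribbon lie on different boundary components, then these are merged when
the ribbon is added. -/
theorem bc_insert_of_ends_ne [Finite V₀] [Finite E] (G : RibbonGraph V₀ E) {S : Set E} {e : E}
    (he : e ∉ S)
    (h : Quot.mk (G.BoundaryStep S) (e, false, false) ≠ Quot.mk _ (e, true, false)) :
    G.bc S = G.bc (insert e S) + 1 := by
  have h1 : insert e (insert e S)ᶜ = Sᶜ := by
    ext f
    by_cases hf : f = e
    · simp [hf, he]
    · simp [hf]
  -- In the dual the ends of e become its sides, and adding e to S means removing it from the
  -- complement.
  have h2 := G.dual.bc_insert_of_sides_ne (S := (insert e S)ᶜ) (e := e) (by simp) ?_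
  · rwa [h1, bc_dual_compl, bc_dual_compl] at h2
  · rw [h1, dual, Ne, mk_partialDual_eq_iff]
    have h3 : Sᶜ ∆ Set.univ = S := by
      ext e
      simp [Set.mem_symmDiff]
    rw [h3]
    simpa [swapOn] using h

/-! ### The boundary of a vertex disc as a cyclic sequence of corners -/

theorem endFlip_sideFlip (x : E × Bool × Bool) : endFlip (sideFlip x) = sideFlip (endFlip x) := rfl

theorem step_injective (G : RibbonGraph V₀ E) : Function.Injective G.step := by
  intro x y h
  have := congrArg (fun z => endFlip (G.arc z)) h
  simpa [step, G.arc_arc] using this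

theorem step_iterate_succ (G : RibbonGraph V₀ E) (x : E × Bool × Bool) (k : ℕ) :
    G.step^[k + 1] x = G.arc (endFlip (G.step^[k] x)) :=
  Function.iterate_succ_apply' _ _ _

theorem minimalPeriod_step_pos [Finite E] (G : RibbonGraph V₀ E) (x : E × Bool × Bool) :
    0 < Function.minimalPeriod G.step x :=
  Function.minimalPeriod_pos_iff_mem_periodicPts.2 (G.step_injective.mem_periodicPts x)

/-- Applying `arc` to a coincidence between positions k and k + d + 2 gives one between k + 1 and k
+ 1 + d. The gap shrinks by two until it contradicts that `endFlip` (gap 0) or `arc` (gap 1) has no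
fixed point. -/
theorem endFlip_step_iterate_ne_add (G : RibbonGraph V₀ E) (x : E × Bool × Bool) (d k : ℕ) :
    endFlip (G.step^[k] x) ≠ G.step^[k + d] x := by
  induction d using Nat.twoStepInduction generalizing k with
  | zero => exact endFlip_ne _
  | one =>
    rw [step_iterate_succ]
    exact (G.arc_ne _).symm
  | more d ih _ =>
    intro h
    apply ih (k + 1)
    rw [step_iterate_succ, h, show k + (d + 2) = (k + 1 + d) + 1 by ring, step_iterate_succ,
      G.arc_arc, endFlip_endFlip]

/-- A corner and its companion at the same ribbon end are met in opposite directions. -/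
theorem endFlip_step_iterate_ne (G : RibbonGraph V₀ E) (x : E × Bool × Bool) (k l : ℕ) :
    endFlip (G.step^[k] x) ≠ G.step^[l] x := by
  rcases le_total k l with h | h
  · obtain ⟨d, rfl⟩ := Nat.exists_eq_add_of_le h
    exact G.endFlip_step_iterate_ne_add x d k
  · obtain ⟨d, rfl⟩ := Nat.exists_eq_add_of_le h
    intro h
    exact G.endFlip_step_iterate_ne_add x d l (by rw [← h, endFlip_endFlip])

theorem step_iterate_inj (G : RibbonGraph V₀ E) {x : E × Bool × Bool} {k l : ℕ}
    (hk : k < Function.minimalPeriod G.step x) (hl : l < Function.minimalPeriod G.step x)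
    (h : G.step^[k] x = G.step^[l] x) : k = l :=
  (Function.iterate_eq_iterate_iff_of_lt_minimalPeriod hk hl).1 h

/-- Two different visits to the ribbon of `e` are visits to its two ends. -/
theorem step_iterate_eq_of_fst_eq (G : RibbonGraph V₀ E) {x : E × Bool × Bool} {k l : ℕ}
    (hk : k < Function.minimalPeriod G.step x) (hl : l < Function.minimalPeriod G.step x)
    (hkl : k ≠ l) (h : (G.step^[l] x).1 = (G.step^[k] x).1) :
    G.step^[l] x = sideFlip (G.step^[k] x) ∨
      G.step^[l] x = sideFlip (endFlip (G.step^[k] x)) := by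
  rcases corner_cases h with h | h | h | h
  · exact absurd (G.step_iterate_inj hl hk h).symm hkl
  · exact absurd h.symm (G.endFlip_step_iterate_ne x k l)
  · exact Or.inl h
  · exact Or.inr h

/-- A ribbon is visited at most twice. -/
theorem eq_of_three_visits (G : RibbonGraph V₀ E) {x : E × Bool × Bool} {k l m : ℕ}
    (hk : k < Function.minimalPeriod G.step x) (hl : l < Function.minimalPeriod G.step x)
    (hm : m < Function.minimalPeriod G.step x) (hkl : k ≠ l) (hkm : k ≠ m)
    (h : (G.step^[l] x).1 = (G.step^[k] x).1) (h' : (G.step^[m] x).1 = (G.step^[k] x).1) :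
    l = m := by
  have hlm := G.endFlip_step_iterate_ne x l m
  have hml := G.endFlip_step_iterate_ne x m l
  -- The two possible corners for a second visit are exchanged by `endFlip`, so the orbit cannot
  -- contain both.
  rcases G.step_iterate_eq_of_fst_eq hk hl hkl h with h1 | h1 <;>
    rcases G.step_iterate_eq_of_fst_eq hk hm hkm h' with h2 | h2
  · exact G.step_iterate_inj hl hm (h1.trans h2.symm)
  · exact absurd (by rw [h1, h2, endFlip_sideFlip]) hlm
  · exact absurd (by rw [h1, h2, endFlip_sideFlip]) hml
  · exact G.step_iterate_inj hl hm (h1.trans h2.symm)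

/-! ### Ribbon graphs with one boundary component -/

theorem isEmpty_of_bc_eq_one [Finite V₀] [Finite E] {G : RibbonGraph V₀ E} {S : Set E}
    (h : G.bc S = 1) (x : E × Bool × Bool) :
    IsEmpty V₀ ∧ ∀ y z, Quot.mk (G.BoundaryStep S) y = Quot.mk _ z := by
  obtain ⟨h1, -⟩ := Nat.card_eq_one_iff_unique.1 h
  refine ⟨⟨fun v => ?_⟩, fun y z => ?_⟩
  · exact Sum.inl_ne_inr (h1.elim (Sum.inl (Quot.mk _ x)) (Sum.inr v))
  · exact Sum.inl_injective (h1.elim (Sum.inl (Quot.mk _ y)) (Sum.inl (Quot.mk _ z)))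

theorem bc_eq_one_of_mk_eq [IsEmpty V₀] {G : RibbonGraph V₀ E} {S : Set E}
    (x : E × Bool × Bool) (h : ∀ y, Quot.mk (G.BoundaryStep S) y = Quot.mk _ x) :
    G.bc S = 1 := by
  refine Nat.card_eq_one_iff_unique.2 ⟨⟨?_⟩, ⟨Sum.inl (Quot.mk _ x)⟩⟩
  rintro (y | v) (z | w)
  · induction y using Quot.ind
    induction z using Quot.ind
    exact congrArg Sum.inl ((h _).trans (h _).symm)
  · exact isEmptyElim w
  · exact isEmptyElim v
  · exact isEmptyElim v

/-- If there is only one vertex, a turn around it meets all corners. -/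
theorem exists_step_iterate [Finite V₀] [Finite E] {G : RibbonGraph V₀ E} (h : G.bc ∅ = 1)
    (x y : E × Bool × Bool) : ∃ k < Function.minimalPeriod G.step x,
      y = G.step^[k] x ∨ y = endFlip (G.step^[k] x) := by
  suffices H : ∃ k, y = G.step^[k] x ∨ y = endFlip (G.step^[k] x) by
    obtain ⟨k, hk⟩ := H
    exact ⟨_, Nat.mod_lt k (G.minimalPeriod_step_pos x),
      by rwa [Function.iterate_mod_minimalPeriod_eq]⟩
  let P : E × Bool × Bool → Prop := fun y => ∃ k, y = G.step^[k] x ∨ y = endFlip (G.step^[k] x)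
  have harc : ∀ y, P y → P (G.arc y) := by
    rintro y ⟨k, rfl | rfl⟩
    · have hN := G.minimalPeriod_step_pos x
      -- Adding a full period provides a predecessor even for k = 0.
      have hk : G.step^[k] x = G.step^[k + Function.minimalPeriod G.step x] x :=
        Function.iterate_add_minimalPeriod_eq.symm
      obtain ⟨m, hm⟩ : ∃ m, k + Function.minimalPeriod G.step x = m + 1 :=
        ⟨k + Function.minimalPeriod G.step x - 1, by omega⟩
      exact ⟨m, Or.inr (by rw [hk, hm, step_iterate_succ, G.arc_arc])⟩
    · exact ⟨k + 1, Or.inl (G.step_iterate_succ x k).symm⟩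
  have hend : ∀ y, P y → P (endFlip y) := by
    rintro y ⟨k, rfl | rfl⟩
    · exact ⟨k, Or.inr rfl⟩
    · exact ⟨k, Or.inl (endFlip_endFlip _)⟩
  have hr : ∀ y z, G.BoundaryStep ∅ y z → P y = P z := by
    rintro y z (rfl | ⟨h, -⟩ | ⟨-, rfl⟩)
    · exact propext ⟨harc y, fun h => by simpa [G.arc_arc] using harc _ h⟩
    · exact absurd h (Set.notMem_empty _)
    · exact propext ⟨hend y, fun h => by simpa using hend _ h⟩
  have := congrArg (Quot.lift P hr) ((isEmpty_of_bc_eq_one h x).2 x y)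
  exact this.mp ⟨0, Or.inl rfl⟩

/-! ### Loops at a single vertex -/

theorem color_step_iterate (G : RibbonGraph V₀ E) {ε : E × Bool × Bool → Bool}
    (harc : ∀ x, ε (G.arc x) ≠ ε x) (hend : ∀ x, ε (endFlip x) ≠ ε x)
    (x : E × Bool × Bool) (k : ℕ) : ε (G.step^[k] x) = ε x := by
  induction k with
  | zero => rfl
  | succ k ih =>
    rw [← ih, step_iterate_succ]
    have h1 := harc (endFlip (G.step^[k] x))
    have h2 := hend (G.step^[k] x)
    revert h1 h2
    cases ε (G.arc (endFlip (G.step^[k] x))) <;> cases ε (endFlip (G.step^[k] x)) <;>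
      cases ε (G.step^[k] x) <;> simp

/-- An orientable loop is traversed in opposite directions. -/
theorem Orientable.step_iterate_ne {G : RibbonGraph V₀ E} {e : E} (he : G.Orientable {e})
    {x : E × Bool × Bool} (k l : ℕ) (hx : (G.step^[k] x).1 = e) :
    G.step^[l] x ≠ sideFlip (G.step^[k] x) := by
  obtain ⟨ε, hε⟩ := he
  have h := G.color_step_iterate (fun x => (hε x).1) (fun x => (hε x).2.1) x
  intro h'
  have h1 := (hε (G.step^[k] x)).2.2 hx
  rw [← h', h, h] at h1
  exact h1 rfl

/-- If a loop is not orientable, its two ends are traversed in the same direction. -/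
theorem exists_step_iterate_eq_sideFlip [Finite V₀] [Finite E] {G : RibbonGraph V₀ E}
    (h : G.bc ∅ = 1) {e : E} (he : ¬ G.Orientable {e}) (x : E × Bool × Bool) (hx : x.1 = e) :
    ∃ q < Function.minimalPeriod G.step x, G.step^[q] x = sideFlip x := by
  classical
  obtain ⟨q, hq, h1 | h1⟩ := exists_step_iterate h x (sideFlip x)
  · exact ⟨q, hq, h1.symm⟩
  -- Otherwise the two ends are traversed in opposite directions, and colouring corners by
  -- membership in the orbit of x orients the disc and the ribbon: of the corners of e, the orbit
  -- contains exactly x and `endFlip (sideFlip x)`.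
  refine absurd ⟨fun y => decide (∃ k, y = G.step^[k] x), fun y => ?_⟩ he
  have hend : ∀ y, (∃ k, endFlip y = G.step^[k] x) ↔ ¬ ∃ k, y = G.step^[k] x := by
    intro y
    obtain ⟨k, -, rfl | rfl⟩ := exists_step_iterate h x y
    · refine iff_of_false ?_ (not_not.2 ⟨k, rfl⟩)
      rintro ⟨l, hl⟩
      exact G.endFlip_step_iterate_ne x k l hl
    · refine iff_of_true ⟨k, endFlip_endFlip _⟩ ?_
      rintro ⟨l, hl⟩
      exact G.endFlip_step_iterate_ne x k l hl
  have harc : ∀ y, (∃ k, y = G.step^[k] x) ↔ ∃ k, G.arc (endFlip y) = G.step^[k] x := by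
    intro y
    constructor
    · rintro ⟨k, rfl⟩
      exact ⟨k + 1, (G.step_iterate_succ x k).symm⟩
    · rintro ⟨k, hk⟩
      have hN := G.minimalPeriod_step_pos x
      have hk' : G.step^[k] x = G.step^[k + Function.minimalPeriod G.step x] x :=
        Function.iterate_add_minimalPeriod_eq.symm
      obtain ⟨m, hm⟩ : ∃ m, k + Function.minimalPeriod G.step x = m + 1 :=
        ⟨k + Function.minimalPeriod G.step x - 1, by omega⟩
      refine ⟨m, G.step_injective ?_⟩
      rw [← Function.iterate_succ_apply' G.step, Nat.succ_eq_add_one, ← hm, ← hk']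
      exact hk
  simp only [ne_eq, decide_eq_decide]
  refine ⟨?_, ?_, ?_⟩
  · have := harc (endFlip y)
    rw [endFlip_endFlip, hend] at this
    rw [← this]
    tauto
  · rw [hend]
    tauto
  · intro hy
    have hside : ∀ z : E × Bool × Bool, z.1 = e →
        ((∃ k, z = G.step^[k] x) ↔ z = x ∨ z = endFlip (sideFlip x)) := by
      intro z hz
      constructor
      · rintro ⟨k, rfl⟩
        rcases corner_cases (hz.trans hx.symm) with h2 | h2 | h2 | h2
        · exact Or.inl h2
        · exact absurd h2.symm (G.endFlip_step_iterate_ne x 0 k)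
        · exact absurd (h1.symm.trans h2.symm) (G.endFlip_step_iterate_ne x q k)
        · exact Or.inr h2
      · rintro (rfl | rfl)
        · exact ⟨0, rfl⟩
        · exact ⟨q, by rw [h1, endFlip_endFlip]⟩
    rw [hside y hy, hside (sideFlip y) hy]
    obtain ⟨e1, i, j⟩ := x
    obtain ⟨e2, k, l⟩ := y
    obtain rfl : e1 = e := hx
    obtain rfl : e2 = e1 := hy
    cases i <;> cases j <;> cases k <;> cases l <;> simp [endFlip, sideFlip]

/-- Between two consecutive visits to ribbons in `S` one stays on the boundary of `F_S`. -/
theorem mk_step_iterate_eq (G : RibbonGraph V₀ E) {S : Set E} {x : E × Bool × Bool} {a b : ℕ}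
    (hab : a < b) (hS : ∀ k, a < k → k < b → (G.step^[k] x).1 ∉ S) :
    Quot.mk (G.BoundaryStep S) (G.step^[b] x) = Quot.mk _ (endFlip (G.step^[a] x)) := by
  induction b, hab using Nat.le_induction with
  | base =>
    rw [step_iterate_succ]
    exact Eq.symm <| Quot.sound <| Or.inl rfl
  | succ b hab ih =>
    rw [← ih fun k h1 h2 => hS k h1 (by omega), step_iterate_succ]
    refine (Quot.sound (r := G.BoundaryStep S) (b := endFlip (G.step^[b] x))
      (Or.inr (Or.inr ⟨hS b hab (by omega), rfl⟩))).trans (Quot.sound (Or.inl rfl)) |>.symm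

/-- On a turn around the only vertex the boundary class can change only when crossing an end of a
ribbon in S. If each such crossing leads back to the class of x, every corner lies in that class. -/
theorem bc_eq_one_of_visits [Finite V₀] [Finite E] {G : RibbonGraph V₀ E} (h : G.bc ∅ = 1)
    {S : Set E} (x : E × Bool × Bool)
    (hS : ∀ k < Function.minimalPeriod G.step x, k = 0 ∨ (G.step^[k] x).1 ∈ S →
      Quot.mk (G.BoundaryStep S) (endFlip (G.step^[k] x)) = Quot.mk _ x) :
    G.bc S = 1 := by
  have := (isEmpty_of_bc_eq_one h x).1
  have hx : ∀ k < Function.minimalPeriod G.step x,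
      Quot.mk (G.BoundaryStep S) (G.step^[k] x) = Quot.mk _ x ∧
        Quot.mk (G.BoundaryStep S) (endFlip (G.step^[k] x)) = Quot.mk _ x := by
    intro k
    induction k with
    | zero => exact fun hk => ⟨rfl, hS 0 hk (Or.inl rfl)⟩
    | succ k ih =>
      intro hk
      have h1 : Quot.mk (G.BoundaryStep S) (G.step^[k + 1] x) = Quot.mk _ x := by
        rw [step_iterate_succ, ← (ih (by omega)).2]
        exact Eq.symm <| Quot.sound <| Or.inl rfl
      refine ⟨h1, ?_⟩
      by_cases hk' : (G.step^[k + 1] x).1 ∈ S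
      · exact hS _ hk (Or.inr hk')
      · rw [← h1]
        exact Eq.symm <| Quot.sound <| Or.inr <| Or.inr ⟨hk', rfl⟩
  refine bc_eq_one_of_mk_eq x fun y => ?_
  obtain ⟨k, hk, rfl | rfl⟩ := exists_step_iterate h x y
  exacts [(hx k hk).1, (hx k hk).2]

theorem mk_sideFlip_eq (G : RibbonGraph V₀ E) {S : Set E} {x : E × Bool × Bool} (hx : x.1 ∈ S) :
    Quot.mk (G.BoundaryStep S) (sideFlip x) = Quot.mk _ x :=
  Eq.symm <| Quot.sound <| Or.inr <| Or.inl ⟨hx, rfl⟩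

/-- A disc with one twisted ribbon is a Möbius band: the two segments between the ends of e are
joined by the sides into one circle. -/
theorem bc_singleton_of_not_orientable [Finite V₀] [Finite E] {G : RibbonGraph V₀ E}
    (h : G.bc ∅ = 1) {e : E} (he : ¬ G.Orientable {e}) : G.bc {e} = 1 := by
  set x : E × Bool × Bool := (e, false, false) with hx
  obtain ⟨q, hq, hqx⟩ := exists_step_iterate_eq_sideFlip h he x rfl
  have hN := G.minimalPeriod_step_pos x
  have hq0 : q ≠ 0 := by
    rintro rfl
    exact sideFlip_ne x hqx.symm
  have hvis : ∀ k < Function.minimalPeriod G.step x, (G.step^[k] x).1 ∈ ({e} : Set E) →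
      k = 0 ∨ k = q := by
    intro k hk hke
    by_contra! hcon
    exact hcon.2 (G.eq_of_three_visits hN hk hq hcon.1.symm hq0.symm hke (by rw [hqx]; rfl))
  have s1 := G.mk_step_iterate_eq (S := {e}) (x := x) (Nat.pos_of_ne_zero hq0) fun k h1 h2 h3 => by
    have := hvis k (by omega) h3
    omega
  have s2 := G.mk_step_iterate_eq (S := {e}) (x := x) hq fun k h1 h2 h3 => by
    have := hvis k (by omega) h3
    omega
  rw [Function.iterate_minimalPeriod] at s2
  rw [hqx, G.mk_sideFlip_eq (Set.mem_singleton e)] at s1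
  refine bc_eq_one_of_visits h x fun k hk hk' => ?_
  rcases (hk'.elim Or.inl (hvis k hk) : k = 0 ∨ k = q) with rfl | rfl
  · exact s1.symm
  · exact s2.symm

theorem Alternate.ne {G : RibbonGraph V₀ E} {e f : E} (h : G.Alternate e f) : f ≠ e := by
  obtain ⟨x, p, q, r, hp, hpq, hqr, hr, h0, h1, h2, h3⟩ := h
  rintro rfl
  have := G.eq_of_three_visits (x := x) (k := 0) (l := p) (m := q) (by omega) (by omega) (by omega)
    (by omega) (by omega) (h1.trans h0.symm) (h2.trans h0.symm)
  omega

/-- The visits to e, f, e, f cut the vertex boundary into four segments, which the sides of the two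
ribbons join into one circle. The orientability of e fixes how its sides join them; f may be of
either kind. -/
theorem bc_pair_of_alternate [Finite V₀] [Finite E] {G : RibbonGraph V₀ E}
    (h : G.bc ∅ = 1) {e f : E} (he : G.Orientable {e}) (hef : G.Alternate e f) :
    G.bc {e, f} = 1 := by
  have hne := hef.ne
  obtain ⟨x, p, q, r, hp, hpq, hqr, hr, h0, h1, h2, h3⟩ := hef
  have hN := G.minimalPeriod_step_pos x
  have hvis : ∀ k < Function.minimalPeriod G.step x, (G.step^[k] x).1 ∈ ({e, f} : Set E) →
      k = 0 ∨ k = q ∨ k = p ∨ k = r := by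
    rintro k hk (hke | hkf)
    · by_contra! hcon
      exact hcon.2.1 (G.eq_of_three_visits (x := x) (k := 0) (by omega) hk (by omega)
        (by omega) (by omega) (hke.trans h0.symm) (h2.trans h0.symm))
    · by_contra! hcon
      exact hcon.2.2.2 (G.eq_of_three_visits (x := x) (k := p) (by omega) hk (by omega)
        (by omega) (by omega) (Eq.trans hkf h1.symm) (h3.trans h1.symm))
  have hseg : ∀ {a b}, a < b → b ≤ Function.minimalPeriod G.step x →
      (∀ k, a < k → k < b → k ≠ 0 ∧ k ≠ q ∧ k ≠ p ∧ k ≠ r) →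
      Quot.mk (G.BoundaryStep {e, f}) (G.step^[b] x) = Quot.mk _ (endFlip (G.step^[a] x)) := by
    intro a b hab hb hk
    refine G.mk_step_iterate_eq hab fun k h1 h2 h3 => ?_
    have := hvis k (by omega) h3
    have := hk k h1 h2
    omega
  have s1 := hseg hp (by omega) (by omega)
  have s2 := hseg hpq (by omega) (by omega)
  have s3 := hseg hqr (by omega) (by omega)
  have s4 := hseg hr le_rfl (by omega)
  rw [Function.iterate_minimalPeriod] at s4
  have hq : G.step^[q] x = sideFlip (endFlip x) := by
    rcases G.step_iterate_eq_of_fst_eq (x := x) (k := 0) (l := q) (by omega) (by omega) (by omega)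
      (h2.trans h0.symm) with h | h
    · exact absurd h (he.step_iterate_ne 0 q h0)
    · exact h
  have hxe : x.1 ∈ ({e, f} : Set E) := Or.inl h0
  have hq1 : Quot.mk (G.BoundaryStep {e, f}) (G.step^[q] x) = Quot.mk _ (endFlip x) := by
    rw [hq, G.mk_sideFlip_eq (by exact hxe)]
  have hq2 : Quot.mk (G.BoundaryStep {e, f}) (endFlip (G.step^[q] x)) = Quot.mk _ x := by
    rw [hq, endFlip_sideFlip, endFlip_endFlip, G.mk_sideFlip_eq hxe]
  have hpf : (G.step^[p] x).1 ∈ ({e, f} : Set E) := Or.inr h1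
  have hall : Quot.mk (G.BoundaryStep {e, f}) (endFlip x) = Quot.mk _ x := by
    -- The ends of f may be traversed in the same or in opposite directions; both ways close up the
    -- circle.
    rcases G.step_iterate_eq_of_fst_eq (x := x) (k := p) (l := r) (by omega) (by omega) (by omega)
      (h3.trans h1.symm) with h | h
    · have h4 : Quot.mk (G.BoundaryStep {e, f}) (G.step^[r] x) = Quot.mk _ (G.step^[p] x) := by
        rw [h, G.mk_sideFlip_eq hpf]
      exact s1.symm.trans (h4.symm.trans (s3.trans hq2))
    · have h4 : Quot.mk (G.BoundaryStep {e, f}) (endFlip (G.step^[r] x)) =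
          Quot.mk _ (G.step^[p] x) := by
        rw [h, endFlip_sideFlip, endFlip_endFlip, G.mk_sideFlip_eq hpf]
      exact s1.symm.trans (h4.symm.trans s4.symm)
  refine bc_eq_one_of_visits h x fun k hk hk' => ?_
  rcases (hk'.elim Or.inl (hvis k hk) : k = 0 ∨ k = q ∨ k = p ∨ k = r) with rfl | rfl | rfl | rfl
  · exact hall
  · exact hq2
  · rw [← s2, hq1, hall]
  · exact s4.symm

/-- An orientable loop at the only vertex separates the boundary if no other ribbon links it. -/
theorem sides_ne_of_not_alternate [Finite V₀] [Finite E] {G : RibbonGraph V₀ E}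
    (h : G.bc ∅ = 1) {e : E} (he : G.Orientable {e}) {S : Set E}
    (hS : ∀ f ∈ S, ¬ G.Alternate e f) :
    Quot.mk (G.BoundaryStep (insert e S)) (e, false, false) ≠ Quot.mk _ (e, false, true) := by
  set x : E × Bool × Bool := (e, false, false) with hx
  have hN := G.minimalPeriod_step_pos x
  obtain ⟨q, hq, hqx⟩ := exists_step_iterate h x (sideFlip (endFlip x))
  replace hqx : G.step^[q] x = sideFlip (endFlip x) := by
    rcases hqx with hqx | hqx
    · exact hqx.symm
    · refine absurd ?_ (he.step_iterate_ne (x := x) 0 q rfl)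
      have := congrArg endFlip hqx
      rw [endFlip_endFlip] at this
      rw [← this]
      rfl
  have hq0 : q ≠ 0 := by
    rintro rfl
    exact absurd hqx (by simp [hx, endFlip, sideFlip])
  have hvis : ∀ k < Function.minimalPeriod G.step x, (G.step^[k] x).1 = e → k = 0 ∨ k = q := by
    intro k hk hke
    by_contra! hcon
    exact hcon.2 (G.eq_of_three_visits hN hk hq hcon.1.symm hq0.symm hke (by rw [hqx]; rfl))
  -- The corners met strictly between the two ends of e, together with `endFlip x` and `G.step^[q]
  -- x`, the two corners of one side of e. This set is closed under boundary steps and does not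
  -- contain x, which lies on the other side.
  let C : E × Bool × Bool → Prop := fun y =>
    ∃ k < q, y = endFlip (G.step^[k] x) ∨ y = G.step^[k + 1] x
  have hC : ∀ y, C y → y.1 ≠ e → ∃ k, 0 < k ∧ k < q ∧
      (y = G.step^[k] x ∨ y = endFlip (G.step^[k] x)) := by
    rintro y ⟨k, hk, rfl | rfl⟩ hy
    · refine ⟨k, Nat.pos_of_ne_zero ?_, hk, Or.inr rfl⟩
      rintro rfl
      exact hy rfl
    · refine ⟨k + 1, k.succ_pos, lt_of_le_of_ne hk ?_, Or.inl rfl⟩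
      rintro rfl
      exact hy (by rw [hqx]; rfl)
  have hC' : ∀ {y k}, 0 < k → k < q → y = G.step^[k] x ∨ y = endFlip (G.step^[k] x) → C y := by
    rintro y k hk hkq (rfl | rfl)
    · exact ⟨k - 1, by omega, Or.inr (by rw [Nat.sub_add_cancel hk])⟩
    · exact ⟨k, hkq, Or.inl rfl⟩
  have hstep : ∀ y z, G.BoundaryStep (insert e S) y z → C y → C z := by
    rintro y z (rfl | ⟨hyS, rfl⟩ | ⟨hyS, rfl⟩) hy
    · obtain ⟨k, hk, rfl | rfl⟩ := hy
      · exact ⟨k, hk, Or.inr (G.step_iterate_succ x k).symm⟩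
      · exact ⟨k, hk, Or.inl (by rw [step_iterate_succ, G.arc_arc])⟩
    · by_cases hye : y.1 = e
      · obtain ⟨k, hk, rfl | rfl⟩ := hy
        · obtain rfl | rfl := hvis k (by omega) hye
          · exact ⟨q - 1, by omega, Or.inr (by rw [Nat.sub_add_cancel (by omega), hqx]; rfl)⟩
          · exact absurd rfl hk.ne
        · obtain h1 | rfl := hvis (k + 1) (by omega) hye
          · omega
          · exact ⟨0, by omega, Or.inl (by rw [hqx, sideFlip_sideFlip]; rfl)⟩
      -- A ribbon of S met at p < q has its opposite end before q as well, since an end at r > q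
      -- would alternate with e.
      · obtain ⟨p, hp, hpq, hpy⟩ := hC y hy hye
        have hp1 : (G.step^[p] x).1 = y.1 := by rcases hpy with rfl | rfl <;> rfl
        obtain ⟨r, hr, hry⟩ := exists_step_iterate h x (sideFlip y)
        have hr1 : (G.step^[r] x).1 = y.1 := by
          rcases hry with h1 | h1
          · rw [← h1]; rfl
          · rw [← endFlip_fst (G.step^[r] x), ← h1]; rfl
        have hr0 : r ≠ 0 := by
          rintro rfl
          exact hye hr1.symm
        rcases lt_trichotomy r q with hrq | rfl | hrq
        · exact hC' (by omega) hrq hry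
        · exact absurd (by rw [← hr1, hqx]; rfl) hye
        · exact absurd ⟨x, p, q, r, hp, hpq, hrq, hr, rfl, hp1, by rw [hqx]; rfl, hr1⟩
            (hS y.1 (hyS.resolve_left hye))
    · obtain ⟨k, hk, hkq, hky⟩ := hC y hy fun h => hyS (Or.inl h)
      refine hC' hk hkq ?_
      rcases hky with rfl | rfl
      · exact Or.inr rfl
      · exact Or.inl (endFlip_endFlip _)
  have hsymm : ∀ y z, G.BoundaryStep (insert e S) y z → G.BoundaryStep (insert e S) z y := by
    rintro y z (rfl | ⟨hyS, rfl⟩ | ⟨hyS, rfl⟩)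
    · exact Or.inl (G.arc_arc y).symm
    · exact Or.inr (Or.inl ⟨hyS, (sideFlip_sideFlip y).symm⟩)
    · exact Or.inr (Or.inr ⟨hyS, (endFlip_endFlip y).symm⟩)
  intro heq
  have h1 : C x = C (endFlip x) := congrArg
    (Quot.lift C fun y z hyz => propext ⟨hstep y z hyz, hstep z y (hsymm y z hyz)⟩) heq
  obtain ⟨k, hk, h2 | h2⟩ := h1.mpr ⟨0, by omega, Or.inl rfl⟩
  · exact G.endFlip_step_iterate_ne x k 0 h2.symm
  · exact absurd (G.step_iterate_inj (x := x) (k := 0) (by omega) (by omega) h2) (by omega)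

theorem bc_insert_of_not_alternate [Finite V₀] [Finite E] {G : RibbonGraph V₀ E}
    (h : G.bc ∅ = 1) {e : E} (he : G.Orientable {e}) {S : Set E} (heS : e ∉ S)
    (hS : ∀ f ∈ S, ¬ G.Alternate e f) : G.bc (insert e S) = G.bc S + 1 :=
  G.bc_insert_of_sides_ne heS (sides_ne_of_not_alternate h he hS)

/-! ### Activities and the partition of the spanning subgraphs -/

theorem bc_pos [Finite V₀] [Finite E] (G : RibbonGraph V₀ E) (S : Set E) (e : E) :
    0 < G.bc S := by
  have : Nonempty (G.BoundaryComponent S) := ⟨Sum.inl (Quot.mk _ (e, false, false))⟩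
  have : Finite (G.BoundaryComponent S) := inferInstanceAs (Finite (Quot _ ⊕ V₀))
  exact Nat.card_pos

theorem IsQuasiTree.bc_partialDual_empty {G : RibbonGraph V₀ E} {Q : Set E}
    (hQ : G.IsQuasiTree Q) : (G.partialDual Q).bc ∅ = 1 := by
  rwa [bc_partialDual, ← Set.bot_eq_empty, bot_symmDiff]

section Activities

variable [LinearOrder E]

/-- The live orientable edges. -/
def LiveOrientable (G : RibbonGraph V₀ E) (Q : Set E) : Set E :=
  {e | G.Live Q e ∧ G.OrientableEdge Q e}

/-- Add the edges in increasing order: each is live, so it links none of those already present and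
creates one new boundary component. -/
theorem IsQuasiTree.bc_of_symmDiff_eq [Finite V₀] [Finite E] {G : RibbonGraph V₀ E} {Q : Set E}
    (hQ : G.IsQuasiTree Q) (S : Finset E) (hS : (S : Set E) ⊆ G.LiveOrientable Q) :
    (G.partialDual Q).bc S = 1 + S.card := by
  classical
  induction S using Finset.induction_on_max with
  | empty => simpa using hQ.bc_partialDual_empty
  | insert e S hlt ih =>
    have heS : e ∉ S := fun h => lt_irrefl _ (hlt e h)
    rw [Finset.coe_insert] at hS ⊢
    have he := hS (Set.mem_insert _ _)
    rw [bc_insert_of_not_alternate hQ.bc_partialDual_empty he.2 (by simpa using heS)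
      fun f hf => he.1 f (hlt f hf), ih ((Set.subset_insert _ _).trans hS),
      Finset.card_insert_of_notMem heS, add_assoc]

/-- The number of boundary components of the spanning subgraphs in the interval of `Q`. -/
theorem IsQuasiTree.bc_eq [Finite V₀] [Finite E] {G : RibbonGraph V₀ E} {Q F : Set E}
    (hQ : G.IsQuasiTree Q) (hF : F ∆ Q ⊆ G.LiveOrientable Q) :
    G.bc F = 1 + (F ∆ Q).ncard := by
  have h := hQ.bc_of_symmDiff_eq (Set.toFinite (F ∆ Q)).toFinset (by simpa using hF)
  rw [bc_partialDual, Set.Finite.coe_toFinset, symmDiff_symmDiff_cancel_right] at h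
  rw [h, Set.ncard_eq_toFinset_card]

/-- The live orientable edges are those which cannot be exchanged with the help of lower-ordered
edges. -/
theorem IsQuasiTree.mem_liveOrientable_iff [Finite V₀] [Finite E] {G : RibbonGraph V₀ E}
    {Q : Set E} (hQ : G.IsQuasiTree Q) {e : E} : e ∈ G.LiveOrientable Q ↔
      ∀ Q', G.IsQuasiTree Q' → (∀ f ∈ Q' ∆ Q, f ≤ e) → e ∉ Q' ∆ Q := by
  have h0 := hQ.bc_partialDual_empty
  have hbc : ∀ S, (G.partialDual Q).bc S = 1 → G.IsQuasiTree (S ∆ Q) := fun S hS => by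
    rwa [bc_partialDual] at hS
  constructor
  -- Otherwise e is the greatest element of Q' ∆ Q. Adding it last splits a boundary component,
  -- which leaves at least two.
  · rintro ⟨hl, ho⟩ Q' hQ' hle heD
    have h1 := bc_insert_of_not_alternate (S := Q' ∆ Q \ {e}) h0 ho (by simp)
      fun f hf => hl f (lt_of_le_of_ne (hle f hf.1) hf.2)
    rw [Set.insert_sdiff_self_of_mem heD, bc_partialDual, symmDiff_symmDiff_cancel_right] at h1
    have h2 := (G.partialDual Q).bc_pos (Q' ∆ Q \ {e}) e
    rw [show G.bc Q' = 1 from hQ'] at h1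
    omega
  · intro h
    -- A nonorientable e can be exchanged alone; an orientable e linking a lower f can be exchanged
    -- together with f.
    have ho : G.OrientableEdge Q e := by
      by_contra ho
      have := h _ (hbc _ (bc_singleton_of_not_orientable h0 ho))
      rw [symmDiff_symmDiff_cancel_right] at this
      exact this (fun f hf => le_of_eq hf) rfl
    refine ⟨fun f hf hlink => ?_, ho⟩
    have := h _ (hbc _ (bc_pair_of_alternate h0 ho hlink))
    rw [symmDiff_symmDiff_cancel_right] at this
    refine this ?_ (Or.inl rfl)
    rintro g (rfl | rfl)
    exacts [le_rfl, hf.le]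

/-- Greedy choice from the greatest edge downwards: U is the initial segment still undecided, and R
records the decisions above it. The hypothesis says that these decisions extend to a quasi-tree. -/
theorem existsUnique_isQuasiTree_aux [Finite V₀] [Finite E] (G : RibbonGraph V₀ E) (F : Set E)
    (U : Finset E) (hU : ∀ e ∈ U, ∀ f ≤ e, f ∈ U) (R : Set E)
    (h : ∃ Q, G.IsQuasiTree Q ∧ ∀ f ∉ U, (f ∈ Q ↔ f ∈ R)) :
    ∃! Q, G.IsQuasiTree Q ∧ (∀ f ∉ U, (f ∈ Q ↔ f ∈ R)) ∧
      ∀ f ∈ U, f ∈ G.LiveOrientable Q ∨ (f ∈ F ↔ f ∈ Q) := by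
  classical
  induction U using Finset.induction_on_max generalizing R with
  | empty =>
    obtain ⟨Q, hQ, hR⟩ := h
    refine ⟨Q, ⟨hQ, hR, by simp⟩, fun Q' hQ' => Set.ext fun f => ?_⟩
    rw [hR f (Finset.notMem_empty f), hQ'.2.1 f (Finset.notMem_empty f)]
  | insert e s hlt ih =>
    have hes : e ∉ s := fun h => lt_irrefl _ (hlt e h)
    replace ih := ih fun a ha f hf => (Finset.mem_insert.1
      (hU a (Finset.mem_insert_of_mem ha) f hf)).resolve_left fun h =>
        absurd (hlt a ha) (h ▸ hf).not_gt
    have hsymm : ∀ {Q Q' : Set E}, (∀ f ∉ insert e s, (f ∈ Q ↔ f ∈ R)) →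
        (∀ f ∉ insert e s, (f ∈ Q' ↔ f ∈ R)) → ∀ f ∈ Q' ∆ Q, f ≤ e := by
      intro Q Q' hQ hQ' f hf
      by_contra hfe
      have hfU : f ∉ insert e s := fun hfU => (Finset.mem_insert.1 hfU).elim
        (fun h => hfe h.le) (fun h => hfe (hlt f h).le)
      rw [Set.mem_symmDiff, hQ f hfU, hQ' f hfU] at hf
      tauto
    -- the status of `e` that agrees with `F` if possible
    obtain ⟨Q₀, hQ₀, hR₀, hmax⟩ : ∃ Q₀, G.IsQuasiTree Q₀ ∧ (∀ f ∉ insert e s, (f ∈ Q₀ ↔ f ∈ R)) ∧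
        ((e ∈ F ↔ e ∈ Q₀) ∨ ∀ Q, G.IsQuasiTree Q → (∀ f ∉ insert e s, (f ∈ Q ↔ f ∈ R)) →
          (e ∈ Q ↔ e ∈ Q₀)) := by
      by_cases hc : ∃ Q₀, G.IsQuasiTree Q₀ ∧ (∀ f ∉ insert e s, (f ∈ Q₀ ↔ f ∈ R)) ∧ (e ∈ F ↔ e ∈ Q₀)
      · obtain ⟨Q₀, h1, h2, h3⟩ := hc
        exact ⟨Q₀, h1, h2, Or.inl h3⟩
      · obtain ⟨Q₀, h1, h2⟩ := h
        refine ⟨Q₀, h1, h2, Or.inr fun Q h3 h4 => ?_⟩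
        push Not at hc
        have := hc Q h3 h4
        have := hc Q₀ h1 h2
        tauto
    -- for the quasi-trees considered, that status is the one of `Q₀`
    have hstatus : ∀ {Q : Set E}, G.IsQuasiTree Q → (∀ f ∉ insert e s, (f ∈ Q ↔ f ∈ R)) →
        ((e ∈ G.LiveOrientable Q ∨ (e ∈ F ↔ e ∈ Q)) ↔ (e ∈ Q ↔ e ∈ Q₀)) := by
      intro Q hQ hQR
      have h1 : e ∈ G.LiveOrientable Q → (e ∈ Q ↔ e ∈ Q₀) := fun hl => by
        have := hQ.mem_liveOrientable_iff.1 hl Q₀ hQ₀ (hsymm hQR hR₀)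
        rw [Set.mem_symmDiff] at this
        tauto
      rcases hmax with hF | hall
      · tauto
      · have h2 := hall Q hQ hQR
        -- The status of e is forced by the edges above it, so e cannot be exchanged and is live
        -- orientable. As U is an initial segment, edges outside it are never at most e.
        refine iff_of_true (Or.inl (hQ.mem_liveOrientable_iff.2 fun Q' hQ' hle hmem => ?_)) h2
        have h3 := hall Q' hQ' fun f hf => by
          rw [← hQR f hf]
          by_contra hne
          refine hf (hU e (Finset.mem_insert_self _ _) f (hle f ?_))
          rw [Set.mem_symmDiff]
          tauto
        rw [Set.mem_symmDiff] at hmem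
        tauto
    have hiff : ∀ Q : Set E, (∀ f ∉ s, (f ∈ Q ↔ f ∈ Q₀)) ↔
        (∀ f ∉ insert e s, (f ∈ Q ↔ f ∈ R)) ∧ (e ∈ Q ↔ e ∈ Q₀) := by
      intro Q
      constructor
      · intro hQ
        refine ⟨fun f hf => ?_, hQ e hes⟩
        rw [hQ f fun h => hf (Finset.mem_insert_of_mem h), hR₀ f hf]
      · rintro ⟨hQ, he⟩ f hf
        by_cases hfe : f = e
        · rwa [hfe]
        · have : f ∉ insert e s := fun h => (Finset.mem_insert.1 h).elim hfe hf
          rw [hQ f this, hR₀ f this]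
    -- Once e is decided, `Q₀` itself serves as the record of decisions outside s.
    refine (existsUnique_congr fun Q => ?_).1 (ih Q₀ ⟨Q₀, hQ₀, fun f _ => Iff.rfl⟩)
    rw [hiff]
    have hfor : (∀ f ∈ insert e s, f ∈ G.LiveOrientable Q ∨ (f ∈ F ↔ f ∈ Q)) ↔
        (e ∈ G.LiveOrientable Q ∨ (e ∈ F ↔ e ∈ Q)) ∧
          ∀ f ∈ s, f ∈ G.LiveOrientable Q ∨ (f ∈ F ↔ f ∈ Q) := by
      simp only [Finset.mem_insert, forall_eq_or_imp]
    rw [hfor]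
    constructor
    · rintro ⟨h1, ⟨h2, h3⟩, h4⟩
      exact ⟨h1, h2, (hstatus h1 h2).2 h3, h4⟩
    · rintro ⟨h1, h2, h3, h4⟩
      exact ⟨h1, ⟨h2, (hstatus h1 h2).1 h3⟩, h4⟩

/-- Every spanning subgraph lies in the interval of exactly one quasi-tree. -/
theorem existsUnique_isQuasiTree [Finite V₀] [Finite E] (G : RibbonGraph V₀ E)
    (h : ∃ Q, G.IsQuasiTree Q) (F : Set E) :
    ∃! Q, G.IsQuasiTree Q ∧ F ∆ Q ⊆ G.LiveOrientable Q := by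
  have := Fintype.ofFinite E
  obtain ⟨Q₀, hQ₀⟩ := h
  refine (existsUnique_congr fun Q => ?_).1 (G.existsUnique_isQuasiTree_aux F Finset.univ
    (by simp) ∅ ⟨Q₀, hQ₀, by simp⟩)
  simp only [Finset.mem_univ, not_true_eq_false, false_implies, implies_true, true_and,
    forall_true_left, Set.subset_def, Set.mem_symmDiff]
  refine and_congr_right fun _ => forall_congr' fun f => ?_
  tauto

end Activities

/-! ### Connected components -/

/-- The connected component of `F_H` that contains a given vertex. -/
def component (G : RibbonGraph V₀ E) (H : Set E) (v : G.Vertex) : (G.spanning H).Component :=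
  Quot.mk _ ⟨v, trivial⟩

theorem component_surjective (G : RibbonGraph V₀ E) (H : Set E) :
    Function.Surjective (G.component H) := by
  rintro ⟨v, -⟩
  exact ⟨v, rfl⟩

theorem component_endpoint (G : RibbonGraph V₀ E) {H : Set E} {e : E} (he : e ∈ H) (i : Bool) :
    G.component H (G.endpoint e (!i)) = G.component H (G.endpoint e i) :=
  Eq.symm <| Quot.sound ⟨e, he, i, rfl, rfl⟩

/-- A map on the vertices which identifies the ends of each edge in `H` factors through the
connected components of `F_H`. -/
def componentLift (G : RibbonGraph V₀ E) {H : Set E} {Z : Type*} (f : G.Vertex → Z)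
    (hf : ∀ e ∈ H, f (G.endpoint e true) = f (G.endpoint e false)) :
    (G.spanning H).Component → Z :=
  Quot.lift (fun v => f v.1) (by
    rintro ⟨_, -⟩ ⟨_, -⟩ ⟨e, he, i, rfl, rfl⟩
    cases i
    exacts [(hf e he).symm, hf e he])

instance [Finite V₀] [Finite E] (G : RibbonGraph V₀ E) : Finite G.Vertex :=
  inferInstanceAs (Finite (Quot _ ⊕ V₀))

instance [Finite V₀] [Finite E] (G : RibbonGraph V₀ E) (H : Set E) :
    Finite (G.spanning H).Component :=
  Finite.of_surjective _ (G.component_surjective H)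

instance [Finite V₀] [Finite E] (G : RibbonGraph V₀ E) (H : Set E) :
    Finite (G.BoundaryComponent H) :=
  inferInstanceAs (Finite (Quot _ ⊕ V₀))

theorem c_eq_card (G : RibbonGraph V₀ E) (H : Set E) :
    G.c H = Nat.card (G.spanning H).Component := rfl

theorem c_mono [Finite V₀] [Finite E] (G : RibbonGraph V₀ E) {H H' : Set E} (h : H ⊆ H') :
    G.c H' ≤ G.c H := by
  refine Nat.card_le_card_of_surjective
    (G.componentLift (G.component H') fun e he => G.component_endpoint (h he) false) fun q => ?_
  obtain ⟨v, rfl⟩ := G.component_surjective H' q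
  exact ⟨G.component H v, rfl⟩

theorem c_pos [Finite V₀] [Finite E] (G : RibbonGraph V₀ E) (H : Set E) [Nonempty G.Vertex] :
    0 < G.c H := by
  have : Nonempty (G.spanning H).Component := ⟨G.component H (Classical.arbitrary _)⟩
  exact Nat.card_pos

theorem endpoint_eq_mk (G : RibbonGraph V₀ E) (e : E) (i j : Bool) :
    (Sum.inl (Quot.mk _ (e, i, j)) : G.Vertex) = G.endpoint e i := by
  cases j
  · rfl
  · exact Eq.symm <| congrArg Sum.inl <| Quot.sound <| Or.inr rfl

theorem component_eq_of_boundaryStep (G : RibbonGraph V₀ E) {H : Set E} {x y : E × Bool × Bool}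
    (h : G.BoundaryStep H x y) :
    G.component H (Sum.inl (Quot.mk _ x)) = G.component H (Sum.inl (Quot.mk _ y)) := by
  rcases h with h | ⟨hx, rfl⟩ | ⟨-, h⟩
  · exact congrArg (fun q => G.component H (Sum.inl q)) (Quot.sound (Or.inl h))
  · obtain ⟨e, i, j⟩ := x
    rw [sideFlip, endpoint_eq_mk, endpoint_eq_mk]
    exact (G.component_endpoint hx i).symm
  · exact congrArg (fun q => G.component H (Sum.inl q)) (Quot.sound (Or.inr h))

/-- The connected component of `F_H` to which a boundary component belongs. -/
def boundaryToComponent (G : RibbonGraph V₀ E) (H : Set E) :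
    G.BoundaryComponent H → (G.spanning H).Component :=
  Sum.elim (Quot.lift (fun x => G.component H (Sum.inl (Quot.mk _ x)))
    fun _ _ h => G.component_eq_of_boundaryStep h) (fun v => G.component H (Sum.inr v))

theorem c_le_bc [Finite V₀] [Finite E] (G : RibbonGraph V₀ E) (H : Set E) : G.c H ≤ G.bc H := by
  refine Nat.card_le_card_of_surjective (G.boundaryToComponent H) fun q => ?_
  obtain ⟨x | v, rfl⟩ := G.component_surjective H q
  · obtain ⟨x, rfl⟩ := Quot.exists_rep x
    exact ⟨Sum.inl (Quot.mk _ x), rfl⟩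
  · exact ⟨Sum.inr v, rfl⟩

theorem IsQuasiTree.nonempty_vertex {G : RibbonGraph V₀ E} {Q : Set E} (hQ : G.IsQuasiTree Q) :
    Nonempty G.Vertex := by
  obtain ⟨-, ⟨x | v⟩⟩ := Nat.card_eq_one_iff_unique.1 hQ
  · obtain ⟨x, -⟩ := Quot.exists_rep x
    exact ⟨Sum.inl (Quot.mk _ x)⟩
  · exact ⟨Sum.inr v⟩

theorem IsQuasiTree.c_eq_one [Finite V₀] [Finite E] {G : RibbonGraph V₀ E} {Q : Set E}
    (hQ : G.IsQuasiTree Q) : G.c Q = 1 := by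
  have := hQ.nonempty_vertex
  have h1 := G.c_pos Q
  have h2 := G.c_le_bc Q
  rw [show G.bc Q = 1 from hQ] at h2
  omega

theorem IsQuasiTree.c_univ [Finite V₀] [Finite E] {G : RibbonGraph V₀ E} {Q : Set E}
    (hQ : G.IsQuasiTree Q) : G.c Set.univ = 1 := by
  have := hQ.nonempty_vertex
  have h1 := G.c_pos Set.univ
  have h2 := G.c_mono (Set.subset_univ Q)
  rw [hQ.c_eq_one] at h2
  omega

/-- An edge which does not merge boundary components does not merge connected components. -/
theorem c_insert_of_bc_le [Finite V₀] [Finite E] (G : RibbonGraph V₀ E) {S : Set E} {e : E}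
    (he : e ∉ S) (h : G.bc S ≤ G.bc (insert e S)) : G.c (insert e S) = G.c S := by
  have h1 : Quot.mk (G.BoundaryStep S) (e, false, false) = Quot.mk _ (e, true, false) := by
    by_contra hne
    have := G.bc_insert_of_ends_ne he hne
    omega
  have h2 : G.component S (G.endpoint e true) = G.component S (G.endpoint e false) :=
    (congrArg (fun q => G.boundaryToComponent S (Sum.inl q)) h1).symm
  refine le_antisymm (G.c_mono (Set.subset_insert _ _)) ?_
  refine Nat.card_le_card_of_surjective (G.componentLift (G.component S) fun f hf => ?_)
    fun q => ?_
  · rcases hf with rfl | hf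
    exacts [h2, G.component_endpoint hf false]
  · obtain ⟨v, rfl⟩ := G.component_surjective S q
    exact ⟨G.component _ v, rfl⟩

/-- A connected ribbon graph has a quasi-tree. -/
theorem Connected.exists_isQuasiTree [Finite V₀] [Finite E] {G : RibbonGraph V₀ E}
    (hG : G.Connected) : ∃ Q, G.IsQuasiTree Q := by
  -- At a minimum of bc the four corners of every ribbon lie on one boundary component; otherwise
  -- removing or adding that ribbon would merge two.
  obtain ⟨H, hH⟩ := Finite.exists_min fun H => G.bc H
  have hfour : ∀ e i j, Quot.mk (G.BoundaryStep H) (e, i, j) = Quot.mk _ (e, false, false) := by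
    intro e
    by_cases he : e ∈ H
    · have hside : ∀ j, Quot.mk (G.BoundaryStep H) (e, true, j) = Quot.mk _ (e, false, j) :=
        fun j => G.mk_sideFlip_eq (x := (e, false, j)) he
      have h1 : Quot.mk (G.BoundaryStep H) (e, false, false) = Quot.mk _ (e, false, true) := by
        by_contra hne
        have hins : insert e (H \ {e}) = H := Set.insert_sdiff_self_of_mem he
        have := G.bc_insert_of_sides_ne (S := H \ {e}) (e := e) (by simp) (by rwa [hins])
        have := hH (H \ {e})
        rw [hins] at *
        omega
      intro i j
      cases i <;> cases j <;> simp [hside, h1]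
    · have hend : ∀ i, Quot.mk (G.BoundaryStep H) (e, i, true) = Quot.mk _ (e, i, false) :=
        fun i => Quot.sound (Or.inr (Or.inr ⟨he, rfl⟩))
      have h1 : Quot.mk (G.BoundaryStep H) (e, false, false) = Quot.mk _ (e, true, false) := by
        by_contra hne
        have := G.bc_insert_of_ends_ne he hne
        have := hH (insert e H)
        omega
      intro i j
      cases i <;> cases j <;> simp [hend, h1]
  let f : G.Vertex → G.BoundaryComponent H := Sum.map (Quot.lift (Quot.mk _) (by
    rintro x y (rfl | rfl)
    · exact Quot.sound (Or.inl rfl)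
    · exact (hfour x.1 x.2.1 x.2.2).trans (hfour x.1 x.2.1 (!x.2.2)).symm)) id
  have hc : G.c Set.univ = 1 := by
    have : G.spanning Set.univ = G.graph := G.graph.restrict_self
    rw [c, this]
    exact hG
  -- Sending a vertex to the boundary component through its corners is therefore well defined,
  -- compatible with all edges, and onto.
  have hle : G.bc H ≤ G.c Set.univ := by
    refine Nat.card_le_card_of_surjective (G.componentLift f fun e _ => ?_) ?_
    · exact congrArg Sum.inl (hfour e true false)
    · rintro (x | v)
      · obtain ⟨x, rfl⟩ := Quot.exists_rep x
        exact ⟨G.component _ (Sum.inl (Quot.mk _ x)), rfl⟩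
      · exact ⟨G.component _ (Sum.inr v), rfl⟩
  have hpos : 0 < G.bc H := by
    have hne : Nonempty (G.spanning Set.univ).Component := by
      by_contra hne
      rw [not_nonempty_iff] at hne
      rw [c_eq_card, Nat.card_of_isEmpty] at hc
      omega
    have : Nonempty (G.BoundaryComponent H) :=
      ⟨G.componentLift f (fun e _ => congrArg Sum.inl (hfour e true false)) hne.some⟩
    exact Nat.card_pos
  exact ⟨H, show G.bc H = 1 by omega⟩

/-! ### Graphs of components -/

/-- Contracting the components of D and then joining along I ∩ W is the same as joining along all
these edges at once. This expresses the Tutte exponents through c on G. -/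
theorem numComponents_componentGraph_restrict [Finite V₀] [Finite E] (G : RibbonGraph V₀ E)
    (D I W : Set E) :
    ((G.graph.componentGraph D I).restrict W).numComponents = G.c (D ∪ I ∩ W) := by
  let g : G.Vertex → ((G.graph.componentGraph D I).restrict W).Component := fun v =>
    Quot.mk _ ⟨G.component D v, trivial⟩
  have hg : ∀ e ∈ D ∪ I ∩ W, g (G.endpoint e true) = g (G.endpoint e false) := by
    rintro e (he | ⟨hI, hW⟩)
    · have := G.component_endpoint he false
      simp only [g]
      congr 2
    · exact Quot.sound ⟨e, hW, hI, ⟨_, trivial⟩, ⟨_, trivial⟩, ⟨true, rfl, rfl⟩, rfl, rfl⟩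
  let h : (G.spanning D).Component → (G.spanning (D ∪ I ∩ W)).Component :=
    G.componentLift (G.component _) fun e he => G.component_endpoint (Or.inl he) false
  refine Nat.card_congr
    { toFun := Quot.lift (fun q => h q.1) ?_
      invFun := G.componentLift g hg
      left_inv := ?_
      right_inv := ?_ }
  · rintro ⟨_, -⟩ ⟨_, -⟩ ⟨e, hW, hI, ⟨_, -⟩, ⟨_, -⟩, ⟨i, rfl, rfl⟩, rfl, rfl⟩
    exact (G.component_endpoint (Or.inr ⟨hI, hW⟩) i).symm
  · rintro ⟨q, -⟩
    obtain ⟨v, rfl⟩ := G.component_surjective D q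
    rfl
  · intro q
    obtain ⟨v, rfl⟩ := G.component_surjective _ q
    rfl

theorem tutte_componentGraph [Finite V₀] [Fintype E] (G : RibbonGraph V₀ E) (D I : Set E)
    {K : Type*} [Field K] (X Y : K) [DecidablePred fun W : Set E => W ⊆ I] :
    (G.graph.componentGraph D I).tutte X Y = ∑ W : Set E with W ⊆ I,
      X ^ ((G.c (D ∪ W) : ℤ) - (G.c (D ∪ I) : ℤ)) *
        Y ^ ((W.ncard : ℤ) - (G.c D : ℤ) + (G.c (D ∪ W) : ℤ)) := by
  have hE : (G.graph.componentGraph D I).edgeSet = I := Set.univ_inter I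
  have hI : (G.graph.componentGraph D I).numComponents = G.c (D ∪ I) := by
    rw [← (G.graph.componentGraph D I).restrict_self, numComponents_componentGraph_restrict, hE,
      Set.inter_self]
  refine Finset.sum_congr (by ext W; simp [hE]) fun W hW => ?_
  have hW' : I ∩ W = W := Set.inter_eq_right.2 (Finset.mem_filter.1 hW).2
  have hv : ((G.graph.componentGraph D I).restrict W).vertexSet.ncard = G.c D :=
    Set.ncard_univ _
  have he : ((G.graph.componentGraph D I).restrict W).edgeSet = W := by
    rw [Graph.edgeSet_restrict, hE, hW']
  rw [Graph.nullity, numComponents_componentGraph_restrict, hW', hI, hv, he]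

/-! ### The interval of a quasi-tree -/

theorem swapOn_compl_swapOn_univ (H : Set E) (x : E × Bool × Bool) :
    swapOn Hᶜ (swapOn Set.univ x) = swapOn H x := by
  by_cases hx : x.1 ∈ H <;> simp [swapOn, hx]

theorem swapOn_univ_swapOn_compl (H : Set E) (x : E × Bool × Bool) :
    swapOn Set.univ (swapOn Hᶜ x) = swapOn H x := by
  by_cases hx : x.1 ∈ H <;> simp [swapOn, hx]

/-- Ribbons outside H are swapped twice, those in H once. Hence Q in G and its complement in the
dual have the same links and the same orientable loops, and external statements are internal
statements for the dual. -/
theorem dual_partialDual_compl (G : RibbonGraph V₀ E) (H : Set E) :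
    G.dual.partialDual Hᶜ = G.partialDual H := by
  simp only [dual, partialDual, swapOn_compl_swapOn_univ, swapOn_univ_swapOn_compl]

theorem IsQuasiTree.dual_compl {G : RibbonGraph V₀ E} {Q : Set E} (hQ : G.IsQuasiTree Q) :
    G.dual.IsQuasiTree Qᶜ :=
  (G.bc_dual_compl Q).trans hQ

theorem s_eq (G : RibbonGraph V₀ E) (H : Set E) : G.s H =
    2 * (G.c H : ℤ) - ((Set.univ : Set G.Vertex).ncard : ℤ) + (H.ncard : ℤ) - (G.bc H : ℤ) := by
  have : (G.spanning H).edgeSet = H := Set.univ_inter H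
  rw [s, this]
  rfl

section Activities

variable [LinearOrder E] (G : RibbonGraph V₀ E) (Q : Set E)

theorem Io_eq : G.Io Q = Q ∩ G.LiveOrientable Q := rfl

theorem Eo_eq : G.Eo Q = Qᶜ ∩ G.LiveOrientable Q := rfl

theorem VI_eq : G.VI Q = Q \ G.LiveOrientable Q := by
  ext e
  simp only [VI, DI, In, LiveOrientable, Set.mem_union, Set.mem_ofPred_eq, Set.mem_sdiff]
  tauto

theorem VE_eq : G.VE Q = Qᶜ \ G.LiveOrientable Q := by
  ext e
  simp only [VE, DE, En, LiveOrientable, Set.mem_union, Set.mem_ofPred_eq, Set.mem_sdiff,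
    Set.mem_compl_iff]
  tauto

theorem liveOrientable_dual_compl : G.dual.LiveOrientable Qᶜ = G.LiveOrientable Q := by
  simp only [LiveOrientable, Live, Links, OrientableEdge, dual_partialDual_compl]

theorem Io_dual_compl : G.dual.Io Qᶜ = G.Eo Q := by
  rw [Io_eq, Eo_eq, liveOrientable_dual_compl]

theorem VI_dual_compl : G.dual.VI Qᶜ = G.VE Q := by
  rw [VI_eq, VE_eq, liveOrientable_dual_compl]

theorem tutte_internalGraph [Finite V₀] [Fintype E] {K : Type*} [Field K] (X Y : K)
    [DecidablePred fun W : Set E => W ⊆ G.Io Q] :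
    (G.internalGraph Q).tutte X Y = ∑ W : Set E with W ⊆ G.Io Q,
      X ^ ((G.c (G.VI Q ∪ W) : ℤ) - (G.c (G.VI Q ∪ G.Io Q) : ℤ)) *
        Y ^ ((W.ncard : ℤ) - (G.c (G.VI Q) : ℤ) + (G.c (G.VI Q ∪ W) : ℤ)) :=
  G.tutte_componentGraph (G.VI Q) (G.Io Q) X Y

theorem tutte_externalGraph [Finite V₀] [Fintype E] {K : Type*} [Field K] (X Y : K)
    [DecidablePred fun W : Set E => W ⊆ G.Eo Q] :
    (G.externalGraph Q).tutte X Y = ∑ W : Set E with W ⊆ G.Eo Q,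
      X ^ ((G.dual.c (G.VE Q ∪ W) : ℤ) - (G.dual.c (G.VE Q ∪ G.Eo Q) : ℤ)) *
        Y ^ ((W.ncard : ℤ) - (G.dual.c (G.VE Q) : ℤ) + (G.dual.c (G.VE Q ∪ W) : ℤ)) :=
  G.dual.tutte_componentGraph (G.VE Q) (G.Eo Q) X Y

variable {G Q} {F : Set E}

theorem VI_union_Io : G.VI Q ∪ G.Io Q = Q := by
  rw [VI_eq, Io_eq, Set.sdiff_union_inter]

/-- In the interval of `Q`, the components of a subgraph do not depend on its external edges. -/
theorem IsQuasiTree.c_eq [Finite V₀] [Finite E] (hQ : G.IsQuasiTree Q)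
    (hF : F ∆ Q ⊆ G.LiveOrientable Q) : G.c F = G.c (G.VI Q ∪ F ∩ G.Io Q) := by
  classical
  -- Add the external edges one at a time. Each enlarges the symmetric difference with Q inside the
  -- interval, so bc grows and no connected components merge.
  have key : ∀ T : Finset E, (T : Set E) ⊆ G.Eo Q →
      G.c (G.VI Q ∪ F ∩ G.Io Q ∪ T) = G.c (G.VI Q ∪ F ∩ G.Io Q) := by
    intro T
    induction T using Finset.induction_on with
    | empty => simp
    | insert e T heT ih =>
      intro hT
      rw [Finset.coe_insert] at hT ⊢
      have hT' := (Set.subset_insert _ _).trans hT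
      have he := hT (Set.mem_insert _ _)
      have heP : e ∉ G.VI Q ∪ F ∩ G.Io Q ∪ T := by
        rintro ((h | h) | h)
        · rw [VI_eq] at h
          exact he.1 h.1
        · exact he.1 h.2.1
        · exact heT h
      have hsub : (G.VI Q ∪ F ∩ G.Io Q ∪ T) ∆ Q ⊆ G.LiveOrientable Q := by
        intro f hf
        rw [VI_eq, Io_eq, Set.mem_symmDiff] at hf
        by_contra hfl
        have hfT : f ∉ (T : Set E) := fun h => hfl (hT' h).2
        simp only [Set.mem_union, Set.mem_sdiff, Set.mem_inter_iff] at hf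
        tauto
      have hins : insert e (G.VI Q ∪ F ∩ G.Io Q ∪ T) ∆ Q =
          insert e ((G.VI Q ∪ F ∩ G.Io Q ∪ T) ∆ Q) := by
        ext f
        by_cases hfe : f = e
        · subst hfe
          exact iff_of_true (Or.inl ⟨Or.inl rfl, he.1⟩) (Or.inl rfl)
        · simp [Set.mem_symmDiff, hfe]
      rw [Set.union_insert, G.c_insert_of_bc_le heP, ih hT']
      rw [hQ.bc_eq hsub, hQ.bc_eq (by rw [hins]; exact Set.insert_subset he.2 hsub), hins]
      exact Nat.add_le_add_left (Set.ncard_le_ncard (Set.subset_insert _ _)) 1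
  have h := key (Set.toFinite (F ∩ G.Eo Q)).toFinset (by simp)
  rw [← h, Set.Finite.coe_toFinset]
  congr 1
  ext f
  have hf := @hF f
  rw [Set.mem_symmDiff] at hf
  rw [VI_eq, Io_eq, Eo_eq]
  simp only [Set.mem_union, Set.mem_sdiff, Set.mem_inter_iff, Set.mem_compl_iff]
  tauto

/-- An external edge of F adds one both to e and to bc, which cancel. An edge of W = F ∩ Io adds one
to e and lowers bc by one. Together with 2c this makes twice the nullity of W in G_Q. -/
theorem IsQuasiTree.s_eq [Finite V₀] [Finite E] (hQ : G.IsQuasiTree Q)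
    (hF : F ∆ Q ⊆ G.LiveOrientable Q) : G.s F = G.s (G.VI Q) +
      2 * (((F ∩ G.Io Q).ncard : ℤ) - (G.c (G.VI Q) : ℤ) + (G.c (G.VI Q ∪ F ∩ G.Io Q) : ℤ)) := by
  have hVI : G.VI Q ∆ Q = G.Io Q := by
    ext f
    rw [VI_eq, Io_eq, Set.mem_symmDiff]
    simp only [Set.mem_sdiff, Set.mem_inter_iff]
    tauto
  have hFE : F = G.VI Q ∪ F ∩ G.Io Q ∪ F ∩ G.Eo Q := by
    ext f
    have hf := @hF f
    rw [Set.mem_symmDiff] at hf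
    rw [VI_eq, Io_eq, Eo_eq]
    simp only [Set.mem_union, Set.mem_sdiff, Set.mem_inter_iff, Set.mem_compl_iff]
    tauto
  have hFQ : F ∆ Q = G.Io Q \ (F ∩ G.Io Q) ∪ F ∩ G.Eo Q := by
    ext f
    have hf := @hF f
    rw [Set.mem_symmDiff] at hf ⊢
    rw [Io_eq, Eo_eq]
    simp only [Set.mem_union, Set.mem_sdiff, Set.mem_inter_iff, Set.mem_compl_iff]
    tauto
  have hd1 : Disjoint (G.Io Q) (G.Eo Q) := Set.disjoint_left.2 fun f h h' => h'.1 h.1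
  have hd2 : Disjoint (G.VI Q) (G.Io Q) := by
    rw [VI_eq]
    exact Set.disjoint_left.2 fun f h h' => h.2 h'.2
  have hd3 : Disjoint (G.VI Q) (G.Eo Q) := by
    rw [VI_eq]
    exact Set.disjoint_left.2 fun f h h' => h.2 h'.2
  have hcard1 : F.ncard = (G.VI Q).ncard + (F ∩ G.Io Q).ncard + (F ∩ G.Eo Q).ncard := by
    conv_lhs => rw [hFE]
    rw [Set.ncard_union_eq, Set.ncard_union_eq (hd2.mono_right Set.inter_subset_right)]
    exact Set.disjoint_union_left.2 ⟨hd3.mono_right Set.inter_subset_right,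
      hd1.mono Set.inter_subset_right Set.inter_subset_right⟩
  -- Stated additively to avoid truncated subtraction in ℕ.
  have hcard2 : (F ∆ Q).ncard + (F ∩ G.Io Q).ncard = (G.Io Q).ncard + (F ∩ G.Eo Q).ncard := by
    rw [hFQ, Set.ncard_union_eq (hd1.mono Set.sdiff_subset Set.inter_subset_right), add_right_comm,
      Set.ncard_sdiff_add_ncard_of_subset Set.inter_subset_right]
  have hbc := hQ.bc_eq hF
  have hbcVI := hQ.bc_eq (F := G.VI Q) (by rw [hVI, Io_eq]; exact Set.inter_subset_right)
  rw [hVI] at hbcVI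
  have hc := hQ.c_eq hF
  rw [RibbonGraph.s_eq, RibbonGraph.s_eq, hc]
  omega

end Activities

end RibbonGraph

open Classical in
/-- The contribution of the interval of a quasi-tree to the Krushkal polynomial. -/
theorem RibbonGraph.IsQuasiTree.sum_interval {V₀ E : Type*} [Finite V₀] [Fintype E]
    [LinearOrder E] {G : RibbonGraph V₀ E} {Q : Set E} (hQ : G.IsQuasiTree Q)
    {K : Type*} [Field K] {X Y A B a b : K} (hA : A ≠ 0) (hB : B ≠ 0)
    (ha : a ^ 2 = A) (hb : b ^ 2 = B) :
    (G.internalGraph Q).tutte X A * (G.externalGraph Q).tutte Y B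
        * a ^ G.s (G.VI Q) * b ^ G.dual.s (G.VE Q) =
      ∑ F : Set E with F ∆ Q ⊆ G.LiveOrientable Q,
        X ^ ((G.c F : ℤ) - (G.c Set.univ : ℤ)) * Y ^ ((G.dual.c Fᶜ : ℤ) - (G.dual.c Set.univ : ℤ))
          * a ^ G.s F * b ^ G.dual.s Fᶜ := by
  have hQ' := hQ.dual_compl
  have ha0 : a ≠ 0 := by
    rintro rfl
    exact hA (by rw [← ha]; simp)
  have hb0 : b ≠ 0 := by
    rintro rfl
    exact hB (by rw [← hb]; simp)
  have hcE : G.dual.c (G.VE Q ∪ G.Eo Q) = 1 := by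
    rw [← VI_dual_compl, ← Io_dual_compl, VI_union_Io, hQ'.c_eq_one]
  rw [tutte_internalGraph, tutte_externalGraph,
    Finset.sum_mul_sum, ← Finset.sum_product', Finset.sum_mul, Finset.sum_mul]
  symm
  -- Members of the interval contain VI, avoid VE and are free on Io and Eo. On Eo the complement is
  -- recorded, since these are the edges of F^*.
  refine Finset.sum_bij' (fun F _ => (F ∩ G.Io Q, Fᶜ ∩ G.Eo Q))
    (fun W _ => G.VI Q ∪ W.1 ∪ G.Eo Q \ W.2) ?_ ?_ ?_ ?_ ?_
  · intro F _
    simp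
  · rintro ⟨W, W'⟩ hW
    simp only [Finset.mem_product, Finset.mem_filter, Finset.mem_univ, true_and] at hW ⊢
    intro f hf
    have h1 := @hW.1 f
    rw [VI_eq, Eo_eq, Set.mem_symmDiff] at hf
    rw [Io_eq] at h1
    simp only [Set.mem_union, Set.mem_sdiff, Set.mem_inter_iff, Set.mem_compl_iff] at hf h1
    tauto
  · intro F hF
    ext f
    have hf := @(Finset.mem_filter.1 hF).2 f
    rw [Set.mem_symmDiff] at hf
    simp only [VI_eq, Io_eq, Eo_eq, Set.mem_union, Set.mem_sdiff, Set.mem_inter_iff,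
      Set.mem_compl_iff]
    tauto
  · rintro ⟨W, W'⟩ hW
    simp only [Finset.mem_product, Finset.mem_filter, Finset.mem_univ, true_and] at hW
    refine Prod.ext (Set.ext fun f => ?_) (Set.ext fun f => ?_) <;>
    · have h1 := @hW.1 f
      have h2 := @hW.2 f
      rw [Io_eq] at h1
      rw [Eo_eq] at h2
      simp only [VI_eq, Io_eq, Eo_eq, Set.mem_union, Set.mem_sdiff, Set.mem_inter_iff,
        Set.mem_compl_iff] at h1 h2 ⊢
      tauto
  · intro F hF
    have hF1 := (Finset.mem_filter.1 hF).2
    have hF2 : Fᶜ ∆ Qᶜ ⊆ G.dual.LiveOrientable Qᶜ := by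
      rw [liveOrientable_dual_compl]
      intro f hf
      apply hF1
      rw [Set.mem_symmDiff] at hf ⊢
      simp only [Set.mem_compl_iff] at hf
      tauto
    have hc := hQ.c_eq hF1
    have hs := hQ.s_eq hF1
    have hc' := hQ'.c_eq hF2
    have hs' := hQ'.s_eq hF2
    rw [VI_dual_compl, Io_dual_compl] at hc' hs'
    -- The Tutte exponents are normalized by c(Q), the Krushkal ones by c(G); both are 1, and
    -- likewise in the dual. The factor 2 in `hs` and `hs'` turns powers of a and b into powers of A
    -- and B.
    rw [VI_union_Io, hQ.c_eq_one, hcE, hQ.c_univ, hQ'.c_univ, hs, hs', ← hc, ← hc',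
      zpow_add₀ ha0, zpow_add₀ hb0, zpow_mul a, zpow_mul b]
    rw [show a ^ (2 : ℤ) = A by rw [← ha]; norm_cast, show b ^ (2 : ℤ) = B by rw [← hb]; norm_cast]
    ring

open Classical in
theorem theorem4p2 {V₀ E : Type*} [Finite V₀] [Fintype E] [LinearOrder E]
    (G : RibbonGraph V₀ E) (hG : G.Connected)
    {K : Type*} [Field K] (X Y A B a b : K) (hX : X ≠ 0) (hY : Y ≠ 0)
    (hA : A ≠ 0) (hB : B ≠ 0) (ha : a ^ 2 = A) (hb : b ^ 2 = B) :
    G.krushkal X Y a b =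
      ∑ Q : Set E with G.IsQuasiTree Q,
        (G.internalGraph Q).tutte X A * (G.externalGraph Q).tutte Y B
          * a ^ G.s (G.VI Q) * b ^ G.dual.s (G.VE Q) := by
  have hpart := G.existsUnique_isQuasiTree hG.exists_isQuasiTree
  -- Expand every summand over its interval and exchange the sums; each F then occurs for exactly
  -- one Q.
  rw [Finset.sum_congr rfl fun Q hQ =>
    RibbonGraph.IsQuasiTree.sum_interval (Finset.mem_filter.1 hQ).2 hA hB ha hb,
    Finset.sum_comm' (t' := Finset.univ)
      (s' := fun F => {Q : Set E | G.IsQuasiTree Q ∧ F ∆ Q ⊆ G.LiveOrientable Q})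
      (by simp)]
  refine Finset.sum_congr rfl fun F _ => ?_
  obtain ⟨Q, hQ, huniq⟩ := hpart F
  have hsingle : ({Q : Set E | G.IsQuasiTree Q ∧ F ∆ Q ⊆ G.LiveOrientable Q} : Finset (Set E)) =
      {Q} := by
    ext Q'
    simp only [Finset.mem_filter, Finset.mem_univ, true_and, Finset.mem_singleton]
    exact ⟨huniq Q', fun h => h ▸ hQ⟩
  rw [hsingle, Finset.sum_singleton]
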